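/- Let $1\le n\le N$ and $r\ge 1$ be integers and let $X$ be a smooth (Hausdorff, second countable) manifold of dimension $N$. Let ${\rm Imm}\,T^r_nX$ be the manifold of regular $(r,n)$-velocities, i.e. of $r$-jets $j^r_0\gamma$ at $0\in\mathbb R^n$ of smooth immersions $\gamma$ of a neighbourhood of $0$ into $X$, let $L^r_n$ be the group of invertible $r$-jets $a=j^r_0\alpha$ with source and target $0\in\mathbb R^n$, acting on the right by $j^r_0\gamma\cdot j^r_0\alpha=j^r_0(\gamma\circ\alpha)$, and let $\rho:{\rm Imm}\,T^r_nX\to P^r_nX={\rm Imm}\,T^r_nX/L^r_n$ be the quotient map. For a chart $(V,\psi)$ of $X$, $\psi=(x^A)_{A=1,\dots,N}$, and a subsequence $I=(i_1<\dots<i_n)$ of $(1,\dots,N)$, write $x^k:=x^{i_k}$ $(k=1,\dots,n)$ and $x^\sigma$ ($\sigma\in\{1,\dots,N\}\setminus I$) for the remaining coordinates; let $W=\{j^r_0\gamma : \gamma(0)\in V,\ \det\mathbf x\ne 0\}$, where $\mathbf x=(x^k_j)$, $x^k_j(j^r_0\gamma)=\partial(x^k\circ\gamma)/\partial t^j(0)$,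 and let $z=\mathbf x^{-1}$. The charts of $P^r_nX$ are the sets $\rho(W)$ with coordinates $(x^i,y^\sigma_J)$, $|J|\le r$ ($J$ a symmetric multi-index in $\{1,\dots,n\}$), where $y^\sigma=x^\sigma$ and $y^\sigma_{i_1\dots i_k}=z^j_{i_1}d_j\,y^\sigma_{i_2\dots i_k}$, $d_j$ being the formal derivative (that is, $\partial/\partial t^j$ along $t\mapsto j^r_t\gamma$). On $\rho(W)$ put $D_i=\partial/\partial x^i+\sum_{|J|\le r-1}y^\sigma_{iJ}\,\partial/\partial y^\sigma_J$ (sum over the independent coordinates $y^\sigma_J$) and $\theta_0=dx^1\wedge\dots\wedge dx^n$. Let $\Omega^r_n(PX)$ be the space of smooth $n$-forms on $P^r_nX$ and $\Omega^r_{n(c)}(PX)$ the subspace of contact forms, i.e. of the forms $\xi$ with $[j^r\gamma]^*\xi=0$ for every smooth immersion $\gamma:\mathbb R^n\to X$, where $[j^r\gamma](t)=\rho\big(j^r_0(s\mapsto\gamma(t+s))\big)$; contact forms on the open sets $\rho(W)$ are defined in the same way. Let $\mathcal L$ be a homogeneous Lagrangian: a smooth function on ${\rm Imm}\,T^r_nX$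 with $\mathcal L(x\cdot a)=\det(a)\,\mathcal L(x)$ for all $x$ and all $a\in L^r_n$, where $\det(a)=\det(\partial\alpha^i/\partial t^j(0))$. Then: 1. For every chart $\rho(W)$ there is a smooth function $L$ on $\rho(W)$ (unique, since $\det\mathbf x\neq0$ on $W$) such that $\mathcal L=\det(\mathbf x)\;L\circ\rho$ on $W$. 2. On the overlap of two charts $\rho(W)$ and $\rho(\bar W)$ the corresponding functions satisfy $L=\mathcal J\,\bar L$, with $\mathcal J=\det(D_i\bar x^j)$. 3. There is a unique class $[\lambda]\in\Omega^r_n(PX)/\Omega^r_{n(c)}(PX)$ with local expression $\lambda=L\,\theta_0$ in every chart, i.e. such that for every representative $\lambda$ and every chart $\rho(W)$ the form $\lambda-L\,\theta_0$ is a contact form on $\rho(W)$. -/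

import Mathlib

open scoped Manifold ContDiff Topology

namespace GrassmannJet

/-! ### Partial derivatives and agreement of Taylor coefficients at the origin -/

/-- The parameter space `ℝⁿ` and the model space `ℝᴺ`. -/
abbrev Eucl (n : ℕ) : Type := EuclideanSpace ℝ (Fin n)

/-- The partial derivative `∂f/∂tʲ`. -/
noncomputable def pd {n : ℕ} {F : Type} [NormedAddCommGroup F] [NormedSpace ℝ F]
    (j : Fin n) (f : Eucl n → F) : Eucl n → F :=
  fun t => fderiv ℝ f t (EuclideanSpace.single j 1)

/-- The iterated partial derivative `∂ᵏf/∂tʲ¹⋯∂tʲᵏ`. -/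
noncomputable def pdList {n : ℕ} {F : Type} [NormedAddCommGroup F] [NormedSpace ℝ F] :
    List (Fin n) → (Eucl n → F) → (Eucl n → F)
  | [], f => f
  | j :: J, f => pdList J (pd j f)

/-- `f` and `g` have the same partial derivatives up to order `s` at `0`. -/
def Agree {n : ℕ} {F : Type} [NormedAddCommGroup F] [NormedSpace ℝ F]
    (s : ℕ) (f g : Eucl n → F) : Prop :=
  ∀ J : List (Fin n), J.length ≤ s → pdList J f 0 = pdList J g 0

/-- `f` is smooth on a neighbourhood of `0`. -/
def SmoothNear {n : ℕ} {F : Type} [NormedAddCommGroup F] [NormedSpace ℝ F]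
    (f : Eucl n → F) : Prop :=
  ∀ᶠ t in 𝓝 (0 : Eucl n), ContDiffAt ℝ ∞ f t

section Calculus

variable {n : ℕ} {F G : Type} [NormedAddCommGroup F] [NormedSpace ℝ F]
  [NormedAddCommGroup G] [NormedSpace ℝ G]

theorem contDiffAt_pd {f : Eucl n → F} {t : Eucl n} (hf : ContDiffAt ℝ ∞ f t) (j : Fin n) :
    ContDiffAt ℝ ∞ (pd j f) t :=
  (hf.fderiv_right (m := ∞) (by simp)).clm_apply contDiffAt_const

theorem SmoothNear.pd {f : Eucl n → F} (hf : SmoothNear f) (j : Fin n) :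
    SmoothNear (pd j f) :=
  Filter.Eventually.mono hf fun _ h => contDiffAt_pd h j

theorem SmoothNear.self {f : Eucl n → F} (hf : SmoothNear f) : ContDiffAt ℝ ∞ f 0 :=
  Filter.Eventually.self_of_nhds hf

theorem pd_congr {f g : Eucl n → F} {t : Eucl n} (h : f =ᶠ[𝓝 t] g) (j : Fin n) :
    pd j f =ᶠ[𝓝 t] pd j g := by
  filter_upwards [h.fderiv (𝕜 := ℝ)] with s hs
  simp [GrassmannJet.pd, hs]

theorem pdList_congr {t : Eucl n} (J : List (Fin n)) : ∀ {f g : Eucl n → F}, f =ᶠ[𝓝 t] g →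
    pdList J f =ᶠ[𝓝 t] pdList J g := by
  induction J with
  | nil => intro f g h; exact h
  | cons j J ih => intro f g h; exact ih (pd_congr h j)

theorem Agree.of_eventuallyEq {s : ℕ} {f g f' g' : Eucl n → F} (h : Agree s f g)
    (hf : f' =ᶠ[𝓝 0] f) (hg : g' =ᶠ[𝓝 0] g) : Agree s f' g' := fun J hJ => by
  rw [(pdList_congr J hf).self_of_nhds, (pdList_congr J hg).self_of_nhds, h J hJ]

theorem Agree.refl (s : ℕ) (f : Eucl n → F) : Agree s f f := fun _ _ => rfl

theorem Agree.symm {s : ℕ} {f g : Eucl n → F} (h : Agree s f g) : Agree s g f :=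
  fun J hJ => (h J hJ).symm

theorem Agree.trans {s : ℕ} {f g k : Eucl n → F} (h : Agree s f g) (h' : Agree s g k) :
    Agree s f k := fun J hJ => (h J hJ).trans (h' J hJ)

theorem Agree.mono {s s' : ℕ} {f g : Eucl n → F} (h : Agree s f g) (hs : s' ≤ s) :
    Agree s' f g := fun J hJ => h J (hJ.trans hs)

theorem Agree.zero {s : ℕ} {f g : Eucl n → F} (h : Agree s f g) : f 0 = g 0 :=
  h [] (by simp)

theorem Agree.pd {s : ℕ} {f g : Eucl n → F} (h : Agree (s + 1) f g) (j : Fin n) :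
    Agree s (pd j f) (pd j g) := fun J hJ => h (j :: J) (by simpa using hJ)

theorem agree_zero_iff {f g : Eucl n → F} : Agree 0 f g ↔ f 0 = g 0 := by
  refine ⟨Agree.zero, fun h J hJ => ?_⟩
  obtain rfl : J = [] := by simpa using hJ
  exact h

theorem agree_succ_iff {s : ℕ} {f g : Eucl n → F} :
    Agree (s + 1) f g ↔ f 0 = g 0 ∧ ∀ j, Agree s (GrassmannJet.pd j f) (GrassmannJet.pd j g) := by
  refine ⟨fun h => ⟨h.zero, h.pd⟩, fun ⟨h0, h⟩ J hJ => ?_⟩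
  cases J with
  | nil => exact h0
  | cons j J => exact h j J (by simpa using hJ)

theorem pd_prodMk {f : Eucl n → F} {g : Eucl n → G} {t : Eucl n}
    (hf : ContDiffAt ℝ ∞ f t) (hg : ContDiffAt ℝ ∞ g t) (j : Fin n) :
    pd j (fun t => (f t, g t)) t = (pd j f t, pd j g t) := by
  have h := (hf.differentiableAt (by simp)).hasFDerivAt.prodMk
    (hg.differentiableAt (by simp)).hasFDerivAt
  simp [GrassmannJet.pd, h.fderiv]

theorem SmoothNear.prodMk {f : Eucl n → F} {g : Eucl n → G} (hf : SmoothNear f)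
    (hg : SmoothNear g) : SmoothNear (fun t => (f t, g t)) :=
  (Filter.Eventually.and hf hg).mono fun _ h => h.1.prodMk h.2

theorem Agree.prodMk {s : ℕ} : ∀ {f f' : Eucl n → F} {g g' : Eucl n → G},
    SmoothNear f → SmoothNear f' → SmoothNear g → SmoothNear g' → Agree s f f' → Agree s g g' →
    Agree s (fun t => (f t, g t)) (fun t => (f' t, g' t)) := by
  induction s with
  | zero =>
    intro f f' g g' _ _ _ _ h h'
    rw [agree_zero_iff] at *
    simp [h, h']
  | succ s ih =>
    intro f f' g g' hf hf' hg hg' h h'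
    refine agree_succ_iff.2 ⟨by simp [h.zero, h'.zero], fun j => ?_⟩
    refine (ih (hf.pd j) (hf'.pd j) (hg.pd j) (hg'.pd j) (h.pd j) (h'.pd j)).of_eventuallyEq ?_ ?_
    · filter_upwards [hf, hg] with t h1 h2 using pd_prodMk h1 h2 j
    · filter_upwards [hf', hg'] with t h1 h2 using pd_prodMk h1 h2 j

theorem SmoothNear.comp {f : Eucl n → F} {Φ : F → G} (hf : SmoothNear f)
    (hΦ : ∀ᶠ v in 𝓝 (f 0), ContDiffAt ℝ ∞ Φ v) : SmoothNear (fun t => Φ (f t)) := by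
  have h := hf.self.continuousAt.eventually hΦ
  filter_upwards [hf, h] with t h1 h2 using h2.comp t h1

theorem eventually_contDiffAt_uncurry {Φ : F → G} {v : F}
    (hΦ : ∀ᶠ v in 𝓝 v, ContDiffAt ℝ ∞ Φ v) (w : F) :
    ∀ᶠ p in 𝓝 (v, w), ContDiffAt ℝ ∞ (fun p : F × F => fderiv ℝ Φ p.1 p.2) p := by
  filter_upwards [continuousAt_fst.eventually hΦ] with p hp
  exact ((hp.fderiv_right (m := ∞) (by simp)).comp p contDiffAt_fst).clm_apply contDiffAt_snd

/-- Composition with a smooth map on the left respects agreement to order `s`. -/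
theorem Agree.comp_left {s : ℕ} : ∀ {F : Type} [NormedAddCommGroup F] [NormedSpace ℝ F]
    {f f' : Eucl n → F} {Φ : F → G}, SmoothNear f → SmoothNear f' →
    (∀ᶠ v in 𝓝 (f 0), ContDiffAt ℝ ∞ Φ v) → Agree s f f' →
    Agree s (fun t => Φ (f t)) (fun t => Φ (f' t)) := by
  induction s with
  | zero =>
    intro F _ _ f f' Φ _ _ _ h
    rw [agree_zero_iff] at *
    simp [h]
  | succ s ih =>
    intro F _ _ f f' Φ hf hf' hΦ h
    refine agree_succ_iff.2 ⟨by simp [h.zero], fun j => ?_⟩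
    have hΦ' : ∀ᶠ v in 𝓝 (f' 0), ContDiffAt ℝ ∞ Φ v := h.zero ▸ hΦ
    refine (ih (f := fun t => (f t, GrassmannJet.pd j f t))
      (f' := fun t => (f' t, GrassmannJet.pd j f' t))
      (Φ := fun p : F × F => fderiv ℝ Φ p.1 p.2) (hf.prodMk (hf.pd j)) (hf'.prodMk (hf'.pd j))
      (eventually_contDiffAt_uncurry hΦ _)
      (Agree.prodMk hf hf' (hf.pd j) (hf'.pd j) (h.mono (by simp)) (h.pd j))).of_eventuallyEq ?_ ?_
    · filter_upwards [hf, hf.self.continuousAt.eventually hΦ] with t h1 h2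
      have := (h2.differentiableAt (by simp)).hasFDerivAt.comp t
        (h1.differentiableAt (by simp)).hasFDerivAt
      exact DFunLike.congr_fun this.fderiv (EuclideanSpace.single j 1)
    · filter_upwards [hf', hf'.self.continuousAt.eventually hΦ'] with t h1 h2
      have := (h2.differentiableAt (by simp)).hasFDerivAt.comp t
        (h1.differentiableAt (by simp)).hasFDerivAt
      exact DFunLike.congr_fun this.fderiv (EuclideanSpace.single j 1)

/-- The chain rule in coordinates. -/
theorem pd_comp {f : Eucl n → F} {α : Eucl n → Eucl n} {t : Eucl n}
    (hf : ContDiffAt ℝ ∞ f (α t)) (hα : ContDiffAt ℝ ∞ α t) (j : Fin n) :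
    pd j (fun t => f (α t)) t = ∑ i, pd j α t i • pd i f (α t) := by
  have h := (hf.differentiableAt (by simp)).hasFDerivAt.comp t
    (hα.differentiableAt (by simp)).hasFDerivAt
  have h' : pd j (fun t => f (α t)) t = fderiv ℝ f (α t) (pd j α t) :=
    DFunLike.congr_fun h.fderiv (EuclideanSpace.single j 1)
  rw [h']
  conv_lhs => rw [← (EuclideanSpace.basisFun (Fin n) ℝ).sum_repr (pd j α t)]
  simp [map_sum, GrassmannJet.pd]

theorem SmoothNear.sum {ι : Type} (S : Finset ι) {f : ι → Eucl n → F}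
    (hf : ∀ i, SmoothNear (f i)) : SmoothNear (fun t => ∑ i ∈ S, f i t) := by
  have : ∀ᶠ t in 𝓝 (0 : Eucl n), ∀ i ∈ S, ContDiffAt ℝ ∞ (f i) t :=
    (Filter.eventually_all_finset S).2 fun i _ => hf i
  filter_upwards [this] with t ht using ContDiffAt.sum ht

theorem SmoothNear.smul {a : Eucl n → ℝ} {f : Eucl n → F}
    (ha : SmoothNear a) (hf : SmoothNear f) : SmoothNear (fun t => a t • f t) :=
  (ha.prodMk hf).comp (Φ := fun p : ℝ × F => p.1 • p.2)
    (Filter.Eventually.of_forall fun _ => (contDiff_fst.smul contDiff_snd).contDiffAt)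

theorem Agree.smul {s : ℕ} {a a' : Eucl n → ℝ} {f f' : Eucl n → F}
    (ha : SmoothNear a) (ha' : SmoothNear a') (hf : SmoothNear f) (hf' : SmoothNear f')
    (h : Agree s a a') (h' : Agree s f f') :
    Agree s (fun t => a t • f t) (fun t => a' t • f' t) :=
  (Agree.prodMk ha ha' hf hf' h h').comp_left (Φ := fun p : ℝ × F => p.1 • p.2)
    (ha.prodMk hf) (ha'.prodMk hf')
    (Filter.Eventually.of_forall fun _ => (contDiff_fst.smul contDiff_snd).contDiffAt)

theorem pd_sum {ι : Type} (S : Finset ι) {f : ι → Eucl n → F} {t : Eucl n}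
    (hf : ∀ i ∈ S, ContDiffAt ℝ ∞ (f i) t) (j : Fin n) :
    pd j (fun t => ∑ i ∈ S, f i t) t = ∑ i ∈ S, pd j (f i) t := by
  have h := HasFDerivAt.fun_sum (u := S)
    fun i hi => ((hf i hi).differentiableAt (by simp)).hasFDerivAt
  simp [GrassmannJet.pd, h.fderiv]

theorem Agree.sum {s : ℕ} {ι : Type} (S : Finset ι) : ∀ {f f' : ι → Eucl n → F},
    (∀ i, SmoothNear (f i)) → (∀ i, SmoothNear (f' i)) → (∀ i, Agree s (f i) (f' i)) →
    Agree s (fun t => ∑ i ∈ S, f i t) (fun t => ∑ i ∈ S, f' i t) := by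
  induction s with
  | zero =>
    intro f f' _ _ h
    simp only [agree_zero_iff] at *
    simp [h]
  | succ s ih =>
    intro f f' hf hf' h
    refine agree_succ_iff.2 ⟨by simp [fun i => (h i).zero], fun j => ?_⟩
    refine (ih (fun i => (hf i).pd j) (fun i => (hf' i).pd j)
      fun i => (h i).pd j).of_eventuallyEq ?_ ?_
    · filter_upwards [(Filter.eventually_all_finset S).2 fun i _ => hf i] with t ht
        using pd_sum S ht j
    · filter_upwards [(Filter.eventually_all_finset S).2 fun i _ => hf' i] with t ht
        using pd_sum S ht j

theorem SmoothNear.coord {N : ℕ} {f : Eucl n → Eucl N} (hf : SmoothNear f) (A : Fin N) :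
    SmoothNear (fun t => f t A) :=
  hf.comp (Φ := fun v : Eucl N => v A) (Filter.Eventually.of_forall fun _ =>
    (EuclideanSpace.proj (𝕜 := ℝ) A).contDiff.contDiffAt)

theorem Agree.coord {N s : ℕ} {f f' : Eucl n → Eucl N} (hf : SmoothNear f) (hf' : SmoothNear f')
    (h : Agree s f f') (A : Fin N) : Agree s (fun t => f t A) (fun t => f' t A) :=
  h.comp_left (Φ := fun v : Eucl N => v A) hf hf' (Filter.Eventually.of_forall fun _ =>
    (EuclideanSpace.proj (𝕜 := ℝ) A).contDiff.contDiffAt)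

theorem SmoothNear.comp_right {f : Eucl n → F} {α : Eucl n → Eucl n} (hf : SmoothNear f)
    (hα : SmoothNear α) (h0 : α 0 = 0) : SmoothNear (fun t => f (α t)) :=
  hα.comp (Φ := f) (by rw [h0]; exact hf)

/-- Reparametrization respects agreement to order `s`. -/
theorem Agree.comp_right {s : ℕ} {α : Eucl n → Eucl n} (hα : SmoothNear α) (h0 : α 0 = 0) :
    ∀ {f f' : Eucl n → F}, SmoothNear f → SmoothNear f' → Agree s f f' →
    Agree s (fun t => f (α t)) (fun t => f' (α t)) := by
  induction s with
  | zero =>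
    intro f f' _ _ h
    rw [agree_zero_iff] at *
    simp [h, h0]
  | succ s ih =>
    intro f f' hf hf' h
    refine agree_succ_iff.2 ⟨by simp [h.zero, h0], fun j => ?_⟩
    have ha : ∀ i, SmoothNear (fun t => GrassmannJet.pd j α t i) := fun i => (hα.pd j).coord i
    have key : Agree s (fun t => ∑ i, GrassmannJet.pd j α t i • GrassmannJet.pd i f (α t))
        (fun t => ∑ i, GrassmannJet.pd j α t i • GrassmannJet.pd i f' (α t)) :=
      Agree.sum _ (fun i => (ha i).smul ((hf.pd i).comp_right hα h0))
        (fun i => (ha i).smul ((hf'.pd i).comp_right hα h0))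
        fun i => Agree.smul (ha i) (ha i) ((hf.pd i).comp_right hα h0)
          ((hf'.pd i).comp_right hα h0) (Agree.refl _ _) (ih (hf.pd i) (hf'.pd i) (h.pd i))
    have hc : Filter.Tendsto α (𝓝 0) (𝓝 0) := by
      simpa [ContinuousAt, h0] using hα.self.continuousAt
    refine key.of_eventuallyEq ?_ ?_
    · filter_upwards [hα, hc.eventually hf] with t h1 h2 using pd_comp h2 h1 j
    · filter_upwards [hα, hc.eventually hf'] with t h1 h2 using pd_comp h2 h1 j

end Calculus

/-! ### Inverse matrices and the recursion for the graph coordinates -/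

section Graph

theorem contDiff_det_entries {F : Type} [NormedAddCommGroup F] [NormedSpace ℝ F] {n : ℕ}
    {M : F → Matrix (Fin n) (Fin n) ℝ} (hM : ∀ i j, ContDiff ℝ ∞ fun v => M v i j) :
    ContDiff ℝ ∞ fun v => (M v).det := by
  simp only [Matrix.det_apply]
  exact ContDiff.sum fun σ _ => (contDiff_prod fun i _ => hM _ _).const_smul _

theorem contDiffAt_inv_entry {F : Type} [NormedAddCommGroup F] [NormedSpace ℝ F] {n : ℕ}
    {M : F → Matrix (Fin n) (Fin n) ℝ} (hM : ∀ i j, ContDiff ℝ ∞ fun v => M v i j)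
    {v : F} (hv : (M v).det ≠ 0) (i j : Fin n) :
    ContDiffAt ℝ ∞ (fun v => (M v)⁻¹ i j) v := by
  have h : (fun v => (M v)⁻¹ i j) = fun v => (M v).det⁻¹ * (M v).adjugate i j := by
    funext w
    simp [Matrix.inv_def, Ring.inverse_eq_inv']
  rw [h]
  refine ((contDiff_det_entries hM).contDiffAt.inv hv).mul (ContDiff.contDiffAt ?_)
  simp only [Matrix.adjugate_apply]
  refine contDiff_det_entries fun k l => ?_
  by_cases hk : k = j
  · subst hk
    simpa using contDiff_const
  · simpa [Matrix.updateRow_ne hk] using hM k l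

variable {n N : ℕ}

/-- The matrix `(x^{i_k}_j)` of the first derivatives of the components of `f` selected by the
subsequence `I = (i_1 < ⋯ < i_n)` of `(1, …, N)`. -/
noncomputable def baseJac (I : Fin n ↪o Fin N) (f : Eucl n → Eucl N) (t : Eucl n) :
    Matrix (Fin n) (Fin n) ℝ :=
  Matrix.of fun k j => pd j f t (I k)

/-- The functions `y^σ_{i_1,…,i_k}` along `t ↦ j^r_t f`, given by `y^σ = x^σ` and
`y^σ_{i_1,…,i_k} = z^j_{i_1} d_j y^σ_{i_2,…,i_k}`; here `z` is the inverse of the matrix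
`(x^{i_k}_j)`, and along a prolonged map the formal derivative `d_j` is `∂/∂tʲ`. -/
noncomputable def graphDeriv (I : Fin n ↪o Fin N) (f : Eucl n → Eucl N) (σ : Fin N) :
    List (Fin n) → Eucl n → ℝ
  | [] => fun t => f t σ
  | i :: J => fun t => ∑ j, (baseJac I f t)⁻¹ j i * pd j (graphDeriv I f σ J) t

theorem SmoothNear.pi_pd {f : Eucl n → Eucl N} (hf : SmoothNear f) :
    SmoothNear (fun t => fun j => GrassmannJet.pd j f t) := by
  have : ∀ᶠ t in 𝓝 (0 : Eucl n), ∀ j, ContDiffAt ℝ ∞ (GrassmannJet.pd j f) t :=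
    Filter.eventually_all.2 fun j => hf.pd j
  filter_upwards [this] with t ht using contDiffAt_pi.2 ht

theorem Agree.pi_pd {s : ℕ} {f f' : Eucl n → Eucl N} (hf : SmoothNear f) (hf' : SmoothNear f')
    (h : Agree (s + 1) f f') :
    Agree s (fun t => fun j => GrassmannJet.pd j f t)
      (fun t => fun j => GrassmannJet.pd j f' t) := by
  have e : ∀ g : Eucl n → Eucl N, (fun t => fun j => GrassmannJet.pd j g t) =
      fun t => ∑ j, ContinuousLinearMap.single ℝ (fun _ : Fin n => Eucl N) j
        (GrassmannJet.pd j g t) := by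
    intro g
    funext t
    exact (Finset.univ_sum_single (fun j => GrassmannJet.pd j g t)).symm
  rw [e f, e f']
  have c : ∀ (j : Fin n) (v : Eucl N), ∀ᶠ w in 𝓝 v, ContDiffAt ℝ ∞
      (ContinuousLinearMap.single ℝ (fun _ : Fin n => Eucl N) j) w := fun j v =>
    Filter.Eventually.of_forall fun w => ContinuousLinearMap.contDiff _ |>.contDiffAt
  exact Agree.sum _ (fun j => (hf.pd j).comp (c j _)) (fun j => (hf'.pd j).comp (c j _))
    fun j => (h.pd j).comp_left (hf.pd j) (hf'.pd j) (c j _)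

theorem contDiff_baseEntries (I : Fin n ↪o Fin N) (k l : Fin n) :
    ContDiff ℝ ∞ fun V : Fin n → Eucl N =>
      (Matrix.of fun k j => V j (I k) : Matrix (Fin n) (Fin n) ℝ) k l :=
  ((EuclideanSpace.proj (𝕜 := ℝ) (I k)).comp
    (ContinuousLinearMap.proj (R := ℝ) (φ := fun _ : Fin n => Eucl N) l)).contDiff

theorem eventually_contDiffAt_inv (I : Fin n ↪o Fin N) {V : Fin n → Eucl N}
    (hV : (Matrix.of fun k j => V j (I k) : Matrix (Fin n) (Fin n) ℝ).det ≠ 0) (i j : Fin n) :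
    ∀ᶠ V in 𝓝 V, ContDiffAt ℝ ∞ (fun V : Fin n → Eucl N =>
      (Matrix.of fun k j => V j (I k) : Matrix (Fin n) (Fin n) ℝ)⁻¹ i j) V := by
  filter_upwards [(contDiff_det_entries (contDiff_baseEntries I)).continuous.continuousAt.eventually
    (isOpen_ne.mem_nhds hV)] with W hW
  exact contDiffAt_inv_entry (contDiff_baseEntries I) hW i j

theorem SmoothNear.baseJac_inv (I : Fin n ↪o Fin N) {f : Eucl n → Eucl N} (hf : SmoothNear f)
    (h0 : (baseJac I f 0).det ≠ 0) (i j : Fin n) :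
    SmoothNear (fun t => (baseJac I f t)⁻¹ i j) :=
  hf.pi_pd.comp (eventually_contDiffAt_inv I h0 i j)

theorem Agree.baseJac_zero {s : ℕ} (I : Fin n ↪o Fin N) {f f' : Eucl n → Eucl N}
    (h : Agree (s + 1) f f') : baseJac I f 0 = baseJac I f' 0 := by
  ext k j
  simp [baseJac, (h.pd j).zero]

theorem SmoothNear.graphDeriv (I : Fin n ↪o Fin N) {f : Eucl n → Eucl N} (hf : SmoothNear f)
    (h0 : (baseJac I f 0).det ≠ 0) (σ : Fin N) (J : List (Fin n)) :
    SmoothNear (graphDeriv I f σ J) := by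
  induction J with
  | nil => exact hf.coord σ
  | cons i J ih =>
    exact SmoothNear.sum _ fun j => (hf.baseJac_inv I h0 j i).smul (ih.pd j)

/-- `y^σ_J` depends only on the derivatives of order at most `|J|`. -/
theorem Agree.graphDeriv (I : Fin n ↪o Fin N) {f f' : Eucl n → Eucl N} (hf : SmoothNear f)
    (hf' : SmoothNear f') (h0 : (baseJac I f 0).det ≠ 0) (σ : Fin N) (J : List (Fin n)) :
    ∀ {s : ℕ}, Agree (s + J.length) f f' →
      Agree s (graphDeriv I f σ J) (graphDeriv I f' σ J) := by
  induction J with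
  | nil =>
    intro s h
    exact Agree.coord hf hf' h σ
  | cons i J ih =>
    intro s h
    have hl : s + (i :: J).length = s + J.length + 1 := by simp [Nat.add_assoc]
    rw [hl] at h
    have h0' : (baseJac I f' 0).det ≠ 0 := h.baseJac_zero I ▸ h0
    have hz : ∀ j, Agree s (fun t => (baseJac I f t)⁻¹ j i) (fun t => (baseJac I f' t)⁻¹ j i) :=
      fun j => ((h.mono (s' := s + 1) (by omega)).pi_pd hf hf').comp_left hf.pi_pd hf'.pi_pd
        (eventually_contDiffAt_inv I h0 j i)
    have hy := ih (s := s + 1) (by rwa [Nat.add_right_comm])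
    exact Agree.sum _
      (fun j => (hf.baseJac_inv I h0 j i).smul ((hf.graphDeriv I h0 σ J).pd j))
      (fun j => (hf'.baseJac_inv I h0' j i).smul ((hf'.graphDeriv I h0' σ J).pd j))
      fun j => Agree.smul (hf.baseJac_inv I h0 j i) (hf'.baseJac_inv I h0' j i)
        ((hf.graphDeriv I h0 σ J).pd j) ((hf'.graphDeriv I h0' σ J).pd j) (hz j) (hy.pd j)

/-- The Jacobian matrix `(∂αⁱ/∂tʲ)`. -/
noncomputable def jac (α : Eucl n → Eucl n) (t : Eucl n) : Matrix (Fin n) (Fin n) ℝ :=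
  Matrix.of fun i j => pd j α t i

theorem baseJac_comp (I : Fin n ↪o Fin N) {f : Eucl n → Eucl N} {α : Eucl n → Eucl n}
    {t : Eucl n} (hf : ContDiffAt ℝ ∞ f (α t)) (hα : ContDiffAt ℝ ∞ α t) :
    baseJac I (fun t => f (α t)) t = baseJac I f (α t) * jac α t := by
  ext k j
  simp [baseJac, jac, Matrix.mul_apply, pd_comp hf hα, mul_comm]

theorem eventually_jac_ne {α : Eucl n → Eucl n} (hα : SmoothNear α) (h : (jac α 0).det ≠ 0) :
    ∀ᶠ t in 𝓝 (0 : Eucl n), (jac α t).det ≠ 0 := by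
  have hc : ContinuousAt (fun t => (jac α t).det) 0 := by
    have := (contDiff_det_entries (contDiff_baseEntries
      (RelEmbedding.refl _ : Fin n ↪o Fin n))).continuous.continuousAt.comp
        hα.pi_pd.self.continuousAt
    exact this
  exact hc.eventually (isOpen_ne.mem_nhds h)

/-- The functions `y^σ_J` are invariant under reparametrization. -/
theorem graphDeriv_comp (I : Fin n ↪o Fin N) {f : Eucl n → Eucl N} {α : Eucl n → Eucl n}
    (hf : SmoothNear f) (hα : SmoothNear α) (hα0 : α 0 = 0) (hdet : (jac α 0).det ≠ 0)
    (h0 : (baseJac I f 0).det ≠ 0) (σ : Fin N) (J : List (Fin n)) :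
    graphDeriv I (fun t => f (α t)) σ J =ᶠ[𝓝 0] fun t => graphDeriv I f σ J (α t) := by
  induction J with
  | nil => exact Filter.EventuallyEq.rfl
  | cons i J ih =>
    have hc : Filter.Tendsto α (𝓝 0) (𝓝 0) := by
      simpa [ContinuousAt, hα0] using hα.self.continuousAt
    have hpd : ∀ᶠ t in 𝓝 (0 : Eucl n), ∀ j, pd j (graphDeriv I (fun t => f (α t)) σ J) t =
        pd j (fun t => graphDeriv I f σ J (α t)) t :=
      Filter.eventually_all.2 fun j => pd_congr ih j
    filter_upwards [hpd, hα, hc.eventually hf, hc.eventually (hf.graphDeriv I h0 σ J),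
      eventually_jac_ne hα hdet] with t h1 h2 h3 h4 h5
    simp only [GrassmannJet.graphDeriv, h1, pd_comp h4 h2, baseJac_comp I h3 h2,
      Matrix.mul_inv_rev, Finset.mul_sum, smul_eq_mul]
    rw [Finset.sum_comm]
    refine Finset.sum_congr rfl fun l _ => ?_
    have hu : IsUnit (jac α t).det := isUnit_iff_ne_zero.2 h5
    have key : ∑ j, jac α t l j * ((jac α t)⁻¹ * (baseJac I f (α t))⁻¹) j i =
        (baseJac I f (α t))⁻¹ l i := by
      rw [← Matrix.mul_apply, Matrix.mul_nonsing_inv_cancel_left _ _ hu]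
    rw [← key, Finset.sum_mul]
    refine Finset.sum_congr rfl fun j _ => ?_
    simp only [jac, Matrix.of_apply]
    ring

end Graph

/-! ### Regular velocities -/

section Velocities

variable (n N r : ℕ) (X : Type*) [TopologicalSpace X] [ChartedSpace (Eucl N) X]

/-- Smooth immersions of a neighbourhood of `0 ∈ ℝⁿ` into `X`. -/
structure ImmersionGerm where
  toFun : Eucl n → X
  immersive : ∀ᶠ t in 𝓝 (0 : Eucl n), ContMDiffAt (𝓡 n) (𝓡 N) ∞ toFun t ∧
    Function.Injective (mfderiv (𝓡 n) (𝓡 N) toFun t)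

/-- Smooth local diffeomorphisms of `ℝⁿ` at `0` that fix `0`. -/
structure ReparamGerm where
  toFun : Eucl n → Eucl n
  map_zero : toFun 0 = 0
  smooth : SmoothNear toFun
  det_ne : (jac toFun 0).det ≠ 0

variable {n N X}

theorem smoothNear_chart [IsManifold (𝓡 N) ∞ X] (γ : ImmersionGerm n N X)
    {ψ : OpenPartialHomeomorph X (Eucl N)} (hψ : ψ ∈ IsManifold.maximalAtlas (𝓡 N) ∞ X)
    (h0 : γ.toFun 0 ∈ ψ.source) : SmoothNear (fun t => ψ (γ.toFun t)) := by
  have hc : ContinuousAt γ.toFun 0 := γ.immersive.self_of_nhds.1.continuousAt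
  filter_upwards [γ.immersive, hc.eventually (ψ.open_source.mem_nhds h0)] with t h1 h2
  exact ((contMDiffAt_of_mem_maximalAtlas hψ h2).comp t h1.1).contDiffAt

theorem eventually_contDiffAt_transition [IsManifold (𝓡 N) ∞ X]
    {ψ ψ' : OpenPartialHomeomorph X (Eucl N)} (hψ : ψ ∈ IsManifold.maximalAtlas (𝓡 N) ∞ X)
    (hψ' : ψ' ∈ IsManifold.maximalAtlas (𝓡 N) ∞ X) {x : X} (hx : x ∈ ψ.source)
    (hx' : x ∈ ψ'.source) :
    ∀ᶠ v in 𝓝 (ψ x), ContDiffAt ℝ ∞ (fun v => ψ' (ψ.symm v)) v := by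
  have hc : ContinuousAt ψ.symm (ψ x) := ψ.continuousAt_symm (ψ.map_source hx)
  have h' : ∀ᶠ v in 𝓝 (ψ x), ψ.symm v ∈ ψ'.source :=
    hc.eventually (ψ'.open_source.mem_nhds (by rwa [ψ.left_inv hx]))
  filter_upwards [h', ψ.open_target.mem_nhds (ψ.map_source hx)] with v h1 h2
  exact ((contMDiffAt_of_mem_maximalAtlas hψ' h1).comp v
    (contMDiffAt_symm_of_mem_maximalAtlas hψ h2)).contDiffAt

/-- `γ` and `δ` have the same target at `0` and, in some chart of `X` around it, the same
partial derivatives up to order `r` at `0`. -/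
def JetEq (r : ℕ) (γ δ : ImmersionGerm n N X) : Prop :=
  γ.toFun 0 = δ.toFun 0 ∧
    ∃ ψ ∈ IsManifold.maximalAtlas (𝓡 N) ∞ X, γ.toFun 0 ∈ ψ.source ∧
      Agree r (fun t => ψ (γ.toFun t)) (fun t => ψ (δ.toFun t))

/-- Equality of jets does not depend on the chart. -/
theorem JetEq.agree [IsManifold (𝓡 N) ∞ X] {r : ℕ} {γ δ : ImmersionGerm n N X}
    (h : JetEq r γ δ) {ψ' : OpenPartialHomeomorph X (Eucl N)}
    (hψ' : ψ' ∈ IsManifold.maximalAtlas (𝓡 N) ∞ X) (h0 : γ.toFun 0 ∈ ψ'.source) :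
    Agree r (fun t => ψ' (γ.toFun t)) (fun t => ψ' (δ.toFun t)) := by
  obtain ⟨h1, ψ, hψ, h2, h3⟩ := h
  have h2' : δ.toFun 0 ∈ ψ.source := h1 ▸ h2
  have key := h3.comp_left (Φ := fun v => ψ' (ψ.symm v)) (smoothNear_chart γ hψ h2)
    (smoothNear_chart δ hψ h2') (eventually_contDiffAt_transition hψ hψ' h2 h0)
  refine key.of_eventuallyEq ?_ ?_
  · filter_upwards [γ.immersive.self_of_nhds.1.continuousAt.eventually
      (ψ.open_source.mem_nhds h2)] with t ht
    rw [ψ.left_inv ht]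
  · filter_upwards [δ.immersive.self_of_nhds.1.continuousAt.eventually
      (ψ.open_source.mem_nhds h2')] with t ht
    rw [ψ.left_inv ht]

theorem jetEq_equivalence [IsManifold (𝓡 N) ∞ X] (r : ℕ) :
    Equivalence (JetEq r : ImmersionGerm n N X → ImmersionGerm n N X → Prop) where
  refl γ := ⟨rfl, chartAt (Eucl N) (γ.toFun 0), IsManifold.chart_mem_maximalAtlas _,
    mem_chart_source _ _, Agree.refl _ _⟩
  symm := fun ⟨h1, ψ, hψ, h2, h3⟩ => ⟨h1.symm, ψ, hψ, h1 ▸ h2, h3.symm⟩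
  trans := fun {γ δ ε} h h' => by
    obtain ⟨h1, ψ, hψ, h2, h3⟩ := h
    exact ⟨h1.trans h'.1, ψ, hψ, h2, h3.trans (h'.agree hψ (h1 ▸ h2))⟩

variable (n N X)

/-- Equality of `r`-jets at `0`. -/
def jetSetoid [IsManifold (𝓡 N) ∞ X] : Setoid (ImmersionGerm n N X) :=
  ⟨JetEq r, jetEq_equivalence r⟩

/-- The set `Imm Tʳₙ X` of regular `(r,n)`-velocities `j^r_0 γ`. -/
def Velocity [IsManifold (𝓡 N) ∞ X] : Type _ := Quotient (jetSetoid n N r X)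

/-- Equality of `r`-jets at `0` for reparametrizations. -/
def reparamSetoid : Setoid (ReparamGerm n) where
  r α β := Agree r α.toFun β.toFun
  iseqv := ⟨fun _ => Agree.refl _ _, Agree.symm, Agree.trans⟩

/-- The differential group `Lʳₙ` of invertible `r`-jets with source and target `0 ∈ ℝⁿ`. -/
def DiffGroup : Type := Quotient (reparamSetoid n r)

variable {n N r X}

theorem Agree.jac_zero {α β : Eucl n → Eucl n} [NeZero r] (h : Agree r α β) :
    jac α 0 = jac β 0 := by
  obtain ⟨s, rfl⟩ : ∃ s, r = s + 1 := ⟨r - 1, by have := NeZero.ne r; omega⟩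
  ext i j
  simp [jac, (h.pd j).zero]

/-- `det(a) = det(a^i_j)`. -/
noncomputable def DiffGroup.det [NeZero r] : DiffGroup n r → ℝ :=
  Quotient.lift (fun α : ReparamGerm n => (jac α.toFun 0).det)
    fun _ _ h => congrArg Matrix.det (Agree.jac_zero (r := r) h)

theorem fderiv_injective {α : Eucl n → Eucl n} {t : Eucl n} (h : (jac α t).det ≠ 0) :
    Function.Injective (fderiv ℝ α t) := by
  have hu : IsUnit (jac α t) := (Matrix.isUnit_iff_isUnit_det _).2 (isUnit_iff_ne_zero.2 h)
  have e : ∀ v : Eucl n, ∀ i, fderiv ℝ α t v i = (jac α t).mulVec v.ofLp i := by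
    intro v i
    conv_lhs => rw [← (EuclideanSpace.basisFun (Fin n) ℝ).sum_repr v]
    simp [jac, Matrix.mulVec, dotProduct, pd, mul_comm]
  intro v w hvw
  have h2 : (jac α t).mulVec v.ofLp = (jac α t).mulVec w.ofLp := by
    funext i
    rw [← e, ← e, hvw]
  exact WithLp.ofLp_injective 2 (Matrix.mulVec_injective_iff_isUnit.2 hu h2)

/-- The composition `γ ∘ α`. -/
def ImmersionGerm.comp (γ : ImmersionGerm n N X) (α : ReparamGerm n) : ImmersionGerm n N X where
  toFun t := γ.toFun (α.toFun t)
  immersive := by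
    have hc : Filter.Tendsto α.toFun (𝓝 0) (𝓝 0) := by
      simpa [ContinuousAt, α.map_zero] using α.smooth.self.continuousAt
    filter_upwards [α.smooth, eventually_jac_ne α.smooth α.det_ne, hc.eventually γ.immersive]
      with t h1 h2 h3
    have hα := h1.contMDiffAt
    refine ⟨h3.1.comp t hα, ?_⟩
    have := mfderiv_comp t (h3.1.mdifferentiableAt (by simp)) (hα.mdifferentiableAt (by simp))
    have e : mfderiv (𝓡 n) (𝓡 N) (fun t => γ.toFun (α.toFun t)) t =
      (mfderiv (𝓡 n) (𝓡 N) γ.toFun (α.toFun t)).comp (mfderiv (𝓡 n) (𝓡 n) α.toFun t) := this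
    rw [e, mfderiv_eq_fderiv]
    exact h3.2.comp (fderiv_injective h2)

theorem ImmersionGerm.comp_zero (γ : ImmersionGerm n N X) (α : ReparamGerm n) :
    (γ.comp α).toFun 0 = γ.toFun 0 := by
  simp [ImmersionGerm.comp, α.map_zero]

variable [IsManifold (𝓡 N) ∞ X]

/-- The right action of `Lʳₙ` on regular velocities, `j^r_0 γ · j^r_0 α = j^r_0 (γ ∘ α)`. -/
def Velocity.act : Velocity n N r X → DiffGroup n r → Velocity n N r X :=
  Quotient.lift₂ (fun (γ : ImmersionGerm n N X) (α : ReparamGerm n) =>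
      (Quotient.mk (jetSetoid n N r X) (γ.comp α)))
    fun γ α δ β (h : JetEq r γ δ) (h' : Agree r α.toFun β.toFun) => by
      refine Quotient.sound ⟨?_, ?_⟩
      · rw [γ.comp_zero, δ.comp_zero, h.1]
      · refine ⟨chartAt (Eucl N) (γ.toFun 0), IsManifold.chart_mem_maximalAtlas _, ?_, ?_⟩
        · rw [γ.comp_zero]; exact mem_chart_source _ _
        have hγ := smoothNear_chart γ (IsManifold.chart_mem_maximalAtlas (γ.toFun 0))
          (mem_chart_source (Eucl N) (γ.toFun 0))
        have hδ := smoothNear_chart δ (IsManifold.chart_mem_maximalAtlas (γ.toFun 0))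
          (h.1 ▸ mem_chart_source (Eucl N) (γ.toFun 0))
        have h1 := h'.comp_left (Φ := fun v => chartAt (Eucl N) (γ.toFun 0) (γ.toFun v))
          α.smooth β.smooth (by rw [α.map_zero]; exact hγ)
        exact h1.trans (Agree.comp_right β.smooth β.map_zero hγ hδ
          (h.agree (IsManifold.chart_mem_maximalAtlas _) (mem_chart_source _ _)))

variable (n N r X)

/-- The Grassmannian bundle `Pʳₙ X = Imm Tʳₙ X / Lʳₙ` of `r`-contact elements. -/
def Grassmannian : Type _ :=
  Quot fun x y : Velocity n N r X => ∃ a : DiffGroup n r, y = x.act a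

variable {n N r X}

/-- The canonical projection `ρ : Imm Tʳₙ X → Pʳₙ X`. -/
def Velocity.proj (x : Velocity n N r X) : Grassmannian n N r X := Quot.mk _ x

end Velocities

/-! ### Charts on the velocity manifold and on the Grassmannian bundle -/

/-- Symmetric multi-indices `J = {j_1, …, j_k}` in `{1, …, n}` of length `|J| = k ≤ r`. -/
abbrev MultiIndex (n r : ℕ) : Type := (k : Fin (r + 1)) × Sym (Fin n) k

/-- The non-decreasing sequence `j_1 ≤ ⋯ ≤ j_k` of the entries of a multi-index. -/
def MultiIndex.list {n r : ℕ} (J : MultiIndex n r) : List (Fin n) :=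
  (J.2 : Multiset (Fin n)).sort

theorem MultiIndex.length_list {n r : ℕ} (J : MultiIndex n r) : J.list.length ≤ r := by
  simp only [MultiIndex.list, Multiset.length_sort, Sym.card_coe]
  omega

/-- The charts of the smooth manifold `X`. -/
abbrev BaseChart (N : ℕ) (X : Type*) [TopologicalSpace X] [ChartedSpace (Eucl N) X] : Type _ :=
  {ψ : OpenPartialHomeomorph X (Eucl N) // ψ ∈ IsManifold.maximalAtlas (𝓡 N) ∞ X}

/-- The index set of the associated charts: a chart `(V, ψ)` of `X` together with a subsequence
`I = (i_1 < ⋯ < i_n)` of `(1, …, N)`. -/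
structure AdaptedChart (n N : ℕ) (X : Type*) [TopologicalSpace X] [ChartedSpace (Eucl N) X] where
  ψ : BaseChart N X
  I : Fin n ↪o Fin N

/-- The coordinate space of `(x^i, y^σ_J)`, with `i = 1, …, n`, `σ ∈ {1, …, N} - I`, `|J| ≤ r`. -/
abbrev AdaptedChart.Model {n N : ℕ} {X : Type*} [TopologicalSpace X] [ChartedSpace (Eucl N) X]
    (c : AdaptedChart n N X) (r : ℕ) : Type :=
  (Fin n → ℝ) × ({σ : Fin N // σ ∉ Set.range c.I} → MultiIndex n r → ℝ)

section Charts

variable {n N r : ℕ} {X : Type*} [TopologicalSpace X] [ChartedSpace (Eucl N) X]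
  [IsManifold (𝓡 N) ∞ X]

open Classical in
/-- The coordinates `x^A_J` of the chart `(V^r, ψ^r)` (extended by `0` outside `V^r`). -/
noncomputable def velCoord (ψ : BaseChart N X) : Velocity n N r X → Fin N → MultiIndex n r → ℝ :=
  Quotient.lift (fun γ : ImmersionGerm n N X => if γ.toFun 0 ∈ ψ.1.source then
      fun A J => pdList J.list (fun t => ψ.1 (γ.toFun t)) 0 A else 0)
    fun γ δ (h : JetEq r γ δ) => by
      dsimp only
      by_cases h0 : γ.toFun 0 ∈ ψ.1.source
      · rw [if_pos h0, if_pos (h.1 ▸ h0)]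
        funext A J
        rw [h.agree ψ.2 h0 _ J.length_list]
      · rw [if_neg h0, if_neg (h.1 ▸ h0)]

/-- The target `γ(0)` of the velocity `j^r_0 γ`. -/
def Velocity.target : Velocity n N r X → X :=
  Quotient.lift (fun γ : ImmersionGerm n N X => γ.toFun 0) fun _ _ (h : JetEq r _ _) => h.1

/-- The domain `V^r` of the chart `(V^r, ψ^r)` of the manifold of regular velocities. -/
def velDomain (ψ : BaseChart N X) : Set (Velocity n N r X) := {x | x.target ∈ ψ.1.source}

/-- Smooth real functions on the manifold of regular velocities. -/
def SmoothOnVelocities (f : Velocity n N r X → ℝ) : Prop :=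
  ∀ ψ : BaseChart N X, ∃ g : (Fin N → MultiIndex n r → ℝ) → ℝ,
    ContDiffOn ℝ ∞ g (velCoord ψ '' (velDomain ψ : Set (Velocity n N r X))) ∧
      ∀ x ∈ (velDomain ψ : Set (Velocity n N r X)), f x = g (velCoord ψ x)

theorem Agree.baseJac_zero' [NeZero r] (I : Fin n ↪o Fin N) {f f' : Eucl n → Eucl N}
    (h : Agree r f f') : baseJac I f 0 = baseJac I f' 0 := by
  obtain ⟨s, rfl⟩ : ∃ s, r = s + 1 := ⟨r - 1, by have := NeZero.ne r; omega⟩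
  exact h.baseJac_zero I

/-- The local expression `ψ ∘ γ`. -/
def AdaptedChart.expr (c : AdaptedChart n N X) (γ : ImmersionGerm n N X) : Eucl n → Eucl N :=
  fun t => c.ψ.1 (γ.toFun t)

/-- `j^r_0 γ` lies in the domain `W` of the chart given by `c`. -/
def AdaptedChart.Good (c : AdaptedChart n N X) (γ : ImmersionGerm n N X) : Prop :=
  γ.toFun 0 ∈ c.ψ.1.source ∧ (baseJac c.I (c.expr γ) 0).det ≠ 0

theorem AdaptedChart.Good.of_jetEq [NeZero r] {c : AdaptedChart n N X} {γ δ : ImmersionGerm n N X}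
    (h : JetEq r γ δ) (hγ : c.Good γ) : c.Good δ :=
  ⟨h.1 ▸ hγ.1, (h.agree c.ψ.2 hγ.1).baseJac_zero' c.I ▸ hγ.2⟩

theorem AdaptedChart.good_iff_of_jetEq [NeZero r] {c : AdaptedChart n N X}
    {γ δ : ImmersionGerm n N X} (h : JetEq r γ δ) : c.Good γ ↔ c.Good δ :=
  ⟨.of_jetEq h, .of_jetEq ((jetEq_equivalence r).symm h)⟩

theorem AdaptedChart.good_comp (c : AdaptedChart n N X) (γ : ImmersionGerm n N X)
    (α : ReparamGerm n) : c.Good (γ.comp α) ↔ c.Good γ := by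
  unfold AdaptedChart.Good
  rw [γ.comp_zero]
  refine and_congr_right fun h0 => ?_
  have hf : SmoothNear (c.expr γ) := smoothNear_chart γ c.ψ.2 h0
  have : baseJac c.I (c.expr (γ.comp α)) 0 = baseJac c.I (c.expr γ) 0 * jac α.toFun 0 := by
    have := baseJac_comp (t := 0) c.I (f := c.expr γ) (by rw [α.map_zero]; exact hf.self)
      α.smooth.self
    rwa [α.map_zero] at this
  rw [this, Matrix.det_mul, mul_ne_zero_iff, and_iff_left α.det_ne]

variable [NeZero r]

/-- The chart domain `W = {det (x^{i_k}_j) ≠ 0} ⊆ V^r` in the manifold of regular velocities. -/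
def AdaptedChart.velDomain (c : AdaptedChart n N X) : Set (Velocity n N r X) :=
  fun x => Quotient.liftOn x c.Good fun _ _ h => propext (AdaptedChart.good_iff_of_jetEq h)

open Classical in
/-- The function `det(𝐱) = det (x^{i_k}_j)` on `W` (extended by `0`). -/
noncomputable def AdaptedChart.detX (c : AdaptedChart n N X) : Velocity n N r X → ℝ :=
  Quotient.lift (fun γ : ImmersionGerm n N X => if c.Good γ then
      (baseJac c.I (c.expr γ) 0).det else 0)
    fun γ δ (h : JetEq r γ δ) => by
      by_cases h0 : c.Good γ
      · rw [if_pos h0, if_pos (h0.of_jetEq h)]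
        exact congrArg Matrix.det ((h.agree c.ψ.2 h0.1).baseJac_zero' c.I)
      · rw [if_neg h0, if_neg (mt (AdaptedChart.good_iff_of_jetEq h).2 h0)]

/-- The open set `ρ(W)` of the Grassmannian bundle. -/
def AdaptedChart.domain (c : AdaptedChart n N X) : Set (Grassmannian n N r X) :=
  Velocity.proj '' c.velDomain

open Classical in
/-- The coordinates `(x^i, y^σ_J)` on `W` (extended by `0`). -/
noncomputable def AdaptedChart.velGraphCoord (c : AdaptedChart n N X) :
    Velocity n N r X → c.Model r :=
  Quotient.lift (fun γ : ImmersionGerm n N X => if c.Good γ then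
      (fun i => c.expr γ 0 (c.I i), fun σ J => graphDeriv c.I (c.expr γ) σ J.list 0) else 0)
    fun γ δ (h : JetEq r γ δ) => by
      dsimp only
      by_cases h0 : c.Good γ
      · rw [if_pos h0, if_pos (h0.of_jetEq h)]
        have hA := h.agree c.ψ.2 h0.1
        have hγ : SmoothNear (c.expr γ) := smoothNear_chart γ c.ψ.2 h0.1
        have hδ : SmoothNear (c.expr δ) := smoothNear_chart δ c.ψ.2 (h0.of_jetEq h).1
        refine Prod.ext ?_ ?_
        · funext i
          exact congrArg (fun v : Eucl N => v (c.I i)) hA.zero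
        · funext σ J
          exact (Agree.graphDeriv c.I hγ hδ h0.2 σ J.list
            (s := 0) (hA.mono (by have := J.length_list; omega))).zero
      · rw [if_neg h0, if_neg (mt (AdaptedChart.good_iff_of_jetEq h).2 h0)]

open Classical in
/-- The coordinates `(x^i, y^σ_J)` on `ρ(W)` (extended by `0`). -/
noncomputable def AdaptedChart.coord (c : AdaptedChart n N X) :
    Grassmannian n N r X → c.Model r :=
  Quot.lift c.velGraphCoord fun x y ⟨a, h⟩ => by
    subst h
    induction x using Quotient.inductionOn with | _ γ
    induction a using Quotient.inductionOn with | _ α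
    change (if c.Good γ then _ else _) = (if c.Good (γ.comp α) then _ else _)
    by_cases h0 : c.Good γ
    · rw [if_pos h0, if_pos ((c.good_comp γ α).2 h0)]
      have hγ : SmoothNear (c.expr γ) := smoothNear_chart γ c.ψ.2 h0.1
      refine Prod.ext ?_ ?_
      · funext i
        simp [AdaptedChart.expr, γ.comp_zero]
      · funext σ J
        have := (graphDeriv_comp c.I hγ α.smooth α.map_zero α.det_ne h0.2 σ J.list).self_of_nhds
        have e : graphDeriv c.I (c.expr γ) σ J.list (α.toFun 0) =
            graphDeriv c.I (c.expr γ) σ J.list 0 := by rw [α.map_zero]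
        exact (this.trans e).symm
    · rw [if_neg h0, if_neg (mt (c.good_comp γ α).1 h0)]

open Classical in
/-- The change of charts `(x^i, y^σ_J) ↦ (x̄^i, ȳ^σ_J)` on the image of the overlap
(extended by `0`). -/
noncomputable def AdaptedChart.transition (r : ℕ) [NeZero r] (c c' : AdaptedChart n N X) :
    c.Model r → c'.Model r := fun u =>
  if h : ∃ p : Grassmannian n N r X, (p ∈ c.domain ∧ p ∈ c'.domain) ∧ c.coord p = u then
    c'.coord h.choose else 0

/-- The total derivative `D_i = ∂/∂x^i + ∑_{|J| ≤ r-1} y^σ_{iJ} ∂/∂y^σ_J`, the second sum being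
over the independent coordinates, as a vector at the point `u` of the coordinate space. -/
def AdaptedChart.totalVec (c : AdaptedChart n N X) (i : Fin n) (u : c.Model r) : c.Model r :=
  (Pi.single i 1, fun σ J =>
    if h : (J.1 : ℕ) + 1 < r + 1 then u.2 σ ⟨⟨J.1 + 1, h⟩, Sym.cons i J.2⟩ else 0)

/-- `D_i f`. -/
noncomputable def AdaptedChart.totalDeriv (c : AdaptedChart n N X) (i : Fin n)
    (f : c.Model r → ℝ) (u : c.Model r) : ℝ :=
  fderiv ℝ f u (c.totalVec i u)

/-- `𝒥 = det (D_i x̄^j)`. -/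
noncomputable def AdaptedChart.jacobian (c c' : AdaptedChart n N X) (p : Grassmannian n N r X) :
    ℝ :=
  Matrix.det (Matrix.of fun i j : Fin n =>
    c.totalDeriv i (fun u => (c.transition r c' u).1 j) (c.coord p))

end Charts

/-! ### Differential forms, contact forms, Lagrangians -/

section Forms

/-- Immersions `γ : ℝⁿ → X`. -/
structure Immersion (n N : ℕ) (X : Type*) [TopologicalSpace X] [ChartedSpace (Eucl N) X] where
  toFun : Eucl n → X
  smooth : ContMDiff (𝓡 n) (𝓡 N) ∞ toFun
  injective : ∀ t, Function.Injective (mfderiv (𝓡 n) (𝓡 N) toFun t)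

/-- The germ at `0` of `s ↦ γ(t + s)`. -/
def Immersion.germAt {n N : ℕ} {X : Type*} [TopologicalSpace X] [ChartedSpace (Eucl N) X]
    (γ : Immersion n N X) (t : Eucl n) : ImmersionGerm n N X where
  toFun s := γ.toFun (t + s)
  immersive := by
    refine Filter.Eventually.of_forall fun s => ?_
    have hd : HasFDerivAt (fun s => t + s) (ContinuousLinearMap.id ℝ (Eucl n)) s :=
      (hasFDerivAt_id s).const_add t
    have hs : ContMDiffAt (𝓡 n) (𝓡 n) ∞ (fun s => t + s) s :=
      (contDiff_const.add contDiff_id).contDiffAt.contMDiffAt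
    refine ⟨(γ.smooth (t + s)).comp s hs, ?_⟩
    have e : mfderiv (𝓡 n) (𝓡 N) (fun s => γ.toFun (t + s)) s =
        (mfderiv (𝓡 n) (𝓡 N) γ.toFun (t + s)).comp (mfderiv (𝓡 n) (𝓡 n) (fun s => t + s) s) :=
      mfderiv_comp s ((γ.smooth (t + s)).mdifferentiableAt (by simp))
        (hs.mdifferentiableAt (by simp))
    rw [e, mfderiv_eq_fderiv, hd.fderiv]
    exact γ.injective (t + s)

variable {n N r q : ℕ} {X : Type*} [TopologicalSpace X] [ChartedSpace (Eucl N) X]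
  [IsManifold (𝓡 N) ∞ X]

/-- The map `[j^r γ] : ℝⁿ → Pʳₙ X`, `t ↦ [j^r_t γ]`. -/
def Immersion.prolong (r : ℕ) (γ : Immersion n N X) (t : Eucl n) : Grassmannian n N r X :=
  Velocity.proj (Quotient.mk (jetSetoid n N r X) (γ.germAt t))

variable [NeZero r]

/-- The pull-back by `[j^r γ]` at the parameter `t` of a `q`-covector `a` that is given, in the
chart `c`, at the point `[j^r_t γ]`. -/
noncomputable def AdaptedChart.pullback (r : ℕ) [NeZero r] (c : AdaptedChart n N X)
    (γ : Immersion n N X) (t : Eucl n) (a : c.Model r [⋀^Fin q]→L[ℝ] ℝ) :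
    Eucl n [⋀^Fin q]→L[ℝ] ℝ :=
  a.compContinuousLinearMap (fderiv ℝ (fun s => c.coord (γ.prolong r s)) t)

/-- The `q`-form on `ρ(W)` with value `ξ p` at `p` (in the chart `c`) is contact. -/
def AdaptedChart.ContactOn (c : AdaptedChart n N X)
    (ξ : Grassmannian n N r X → c.Model r [⋀^Fin q]→L[ℝ] ℝ) : Prop :=
  ∀ (γ : Immersion n N X) (t : Eucl n), γ.prolong r t ∈ c.domain →
    c.pullback r γ t (ξ (γ.prolong r t)) = 0

/-- The form `θ₀ = dx¹ ∧ ⋯ ∧ dxⁿ`, `θ₀(v_1, …, v_n) = det (dx^i(v_j))`. -/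
def AdaptedChart.theta (r : ℕ) (c : AdaptedChart n N X) : c.Model r [⋀^Fin n]→L[ℝ] ℝ :=
  { (Matrix.detRowAlternating (R := ℝ) (n := Fin n)).compLinearMap
      (LinearMap.fst ℝ (Fin n → ℝ)
        ({σ : Fin N // σ ∉ Set.range c.I} → MultiIndex n r → ℝ)) with
    cont := by
      change Continuous fun v : Fin n → c.Model r =>
        Matrix.det (fun i j => (v i).1 j : Matrix (Fin n) (Fin n) ℝ)
      refine Continuous.matrix_det ?_
      exact continuous_pi fun i => continuous_pi fun j => by fun_prop }

variable (n N r q X)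

/-- The differential `q`-forms on the manifold `Pʳₙ X`: families of smooth
`q`-forms on the images of the charts `ρ(W)`, related by pull-back along the changes of charts.
The local forms are extended by `0` outside the images of the charts. -/
def formSubmodule : Submodule ℝ ((c : AdaptedChart n N X) → c.Model r → c.Model r [⋀^Fin q]→L[ℝ] ℝ) where
  carrier := {ξ |
    (∀ c, ContDiffOn ℝ ∞ (ξ c) (c.coord '' (c.domain : Set (Grassmannian n N r X)))) ∧
    (∀ c, ∀ u ∉ c.coord '' (c.domain : Set (Grassmannian n N r X)), ξ c u = 0) ∧
    ∀ c c' : AdaptedChart n N X, ∀ p : Grassmannian n N r X, p ∈ c.domain → p ∈ c'.domain →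
      ξ c (c.coord p) = (ξ c' (c'.coord p)).compContinuousLinearMap
        (fderiv ℝ (c.transition r c') (c.coord p))}
  add_mem' := fun {ξ η} hξ hη =>
    ⟨fun c => (hξ.1 c).add (hη.1 c),
      fun c u hu => by simp [hξ.2.1 c u hu, hη.2.1 c u hu],
      fun c c' p h h' => by
        simp only [Pi.add_apply, hξ.2.2 c c' p h h', hη.2.2 c c' p h h']
        rfl⟩
  zero_mem' := ⟨fun c => contDiffOn_const, fun _ _ _ => rfl, fun _ _ _ _ _ => rfl⟩
  smul_mem' := fun a ξ hξ =>
    ⟨fun c => (hξ.1 c).const_smul a, fun c u hu => by simp [hξ.2.1 c u hu],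
      fun c c' p h h' => by
        simp only [Pi.smul_apply, hξ.2.2 c c' p h h']
        rfl⟩

/-- The space `Ω^r_q(PX)` of differential `q`-forms on `Pʳₙ X`. -/
def Form : Type _ := formSubmodule n N r q X

noncomputable instance : AddCommGroup (Form n N r q X) :=
  inferInstanceAs (AddCommGroup (formSubmodule n N r q X))

noncomputable instance : Module ℝ (Form n N r q X) :=
  inferInstanceAs (Module ℝ (formSubmodule n N r q X))

variable {n N r q X}

/-- The local expression of the form `ξ` in the chart `c`. -/
def Form.inChart (ξ : Form n N r q X) (c : AdaptedChart n N X) :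
    c.Model r → c.Model r [⋀^Fin q]→L[ℝ] ℝ :=
  ξ.1 c

variable (n N r q X)

/-- The space `Ω^r_{q(c)}(PX)` of contact `q`-forms: `[j^r γ]^* ξ = 0` for all immersions `γ`. -/
def ContactForm : Submodule ℝ (Form n N r q X) where
  carrier := {ξ | ∀ c : AdaptedChart n N X, c.ContactOn fun p => ξ.inChart c (c.coord p)}
  add_mem' := fun {ξ η} hξ hη c γ t h => by
    have e : c.pullback r γ t ((ξ + η).inChart c (c.coord (γ.prolong r t))) =
        c.pullback r γ t (ξ.inChart c (c.coord (γ.prolong r t))) +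
          c.pullback r γ t (η.inChart c (c.coord (γ.prolong r t))) := rfl
    exact e.trans (by rw [hξ c γ t h, hη c γ t h, add_zero])
  zero_mem' := fun _ _ _ _ => rfl
  smul_mem' := fun a ξ hξ c γ t h => by
    have e : c.pullback r γ t ((a • ξ).inChart c (c.coord (γ.prolong r t))) =
        a • c.pullback r γ t (ξ.inChart c (c.coord (γ.prolong r t))) := rfl
    exact e.trans (by rw [hξ c γ t h, smul_zero])

/-- Homogeneous Lagrangians: smooth functions `ℒ` on the manifold of regular velocities with
`ℒ(x · a) = det(a) ℒ(x)`. -/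
structure HomogeneousLagrangian where
  toFun : Velocity n N r X → ℝ
  smooth : SmoothOnVelocities toFun
  homogeneous : ∀ (x : Velocity n N r X) (a : DiffGroup n r),
    toFun (x.act a) = a.det * toFun x

variable {n N r q X}

/-- `L` is a smooth real function on `ρ(W)` (its values elsewhere are irrelevant). -/
def AdaptedChart.SmoothOn (c : AdaptedChart n N X) (L : Grassmannian n N r X → ℝ) : Prop :=
  ∃ g : c.Model r → ℝ, ContDiffOn ℝ ∞ g (c.coord '' (c.domain : Set (Grassmannian n N r X))) ∧
    ∀ p ∈ (c.domain : Set (Grassmannian n N r X)), L p = g (c.coord p)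

/-- `L` is the non-homogeneous Lagrangian on `ρ(W)` associated to `ℒ`: it is smooth and
`ℒ = det(𝐱) L ∘ ρ` on `W`. -/
def HomogeneousLagrangian.IsLocal (ℒ : HomogeneousLagrangian n N r X) (c : AdaptedChart n N X)
    (L : Grassmannian n N r X → ℝ) : Prop :=
  c.SmoothOn L ∧
    ∀ x ∈ (c.velDomain : Set (Velocity n N r X)), ℒ.toFun x = c.detX x * L x.proj

/-- The class `Λ` of forms modulo contact forms has, in the chart `c`, the local expression
`L θ₀`: every representative differs from `L θ₀` by a contact form on `ρ(W)`. -/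
def HasLocalExpr (Λ : Form n N r n X ⧸ ContactForm n N r n X) (c : AdaptedChart n N X)
    (L : Grassmannian n N r X → ℝ) : Prop :=
  ∀ ξ : Form n N r n X, Submodule.Quotient.mk ξ = Λ →
    c.ContactOn fun p => ξ.inChart c (c.coord p) - L p • c.theta r

end Forms

end GrassmannJet

namespace GrassmannJet

/-! ### Symmetry of iterated partial derivatives -/

section Symmetry

variable {n : ℕ} {F : Type} [NormedAddCommGroup F] [NormedSpace ℝ F]

/-! The orbits of `Lʳₙ` have canonical representatives. If `det 𝐱 ≠ 0` at `j^r_0 γ`, then `t ↦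
x^k(γ(t)) - x^k(γ(0))` is a local diffeomorphism, and reparametrizing `γ` by its inverse `α` turns
it into a graph `x^k = x^k(γ(0)) + t^k` (`exists_reparam_isGraphNear`). Along a graph `𝐱 = 1`, so
the `y^σ_J` are plain partial derivatives, and they can be prescribed at will by polynomials. Hence
`u ↦ j^r_0(graph with coordinates u)` is a section of `ρ` over `ρ(W)`, smooth in the coordinates,
and `x · j^r_0 α` is its value at `ρ(x)`, with `det(j^r_0 α) = det(𝐱)⁻¹`
(`AdaptedChart.exists_act_eq_section`).

Assertion 1: let `L` be `ℒ` composed with this section; homogeneity gives `ℒ = det(𝐱) L ∘ ρ`.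
Assertion 2: evaluate both local formulas on the section of the first chart. There `det 𝐱 = 1`,
while the matrix of the second chart is the transpose of `(D_i x̄^j)`, because the `i`-th partial
derivative of the graph is the projection `E_i` of `D_i` to the base.

Assertion 3: the forms `L θ₀` agree on overlaps only modulo contact forms, so a global
representative has to be produced. Instead of gluing on `Pʳₙ X`, take a Riemannian metric `g` on
`X`. The vectors `E_1, …, E_n` span the contact element, and orthogonal projection onto it defines
the `n`-form `ω(v_1, …, v_n) = det(g(E_i, E_j))⁻¹ det(g(E_i, v_j))`, where `v_j` on the right stands
for its projection to the base. Since `E_i = (D_i x̄^j) Ē_j` (`AdaptedChart.change_totalVec`), the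
second factor scales by `𝒥` and the Gram determinant by `𝒥²`, so `𝒥 ω` is the pull-back of `ω̄`
(`AdaptedChart.metricForm_transition`). With `L = 𝒥 L̄`, the local forms `L ω` are restrictions of
one global form. Tangent vectors to prolongations project to combinations of the `E_k` with
coefficients `dx^k`, and on such vectors `ω` equals `θ₀`
(`AdaptedChart.metricForm_apply_of_horizontal`); thus `L ω - L θ₀` is contact. Uniqueness holds
because being contact is tested chart by chart. -/

theorem pd_comm {f : Eucl n → F} {t : Eucl n} (hf : ContDiffAt ℝ ∞ f t) (i j : Fin n) :
    pd i (pd j f) t = pd j (pd i f) t := by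
  have hd : DifferentiableAt ℝ (fderiv ℝ f) t :=
    (hf.fderiv_right (m := ∞) (by simp)).differentiableAt (by simp)
  have key : ∀ v w : Eucl n, fderiv ℝ (fun s => fderiv ℝ f s v) t w =
      fderiv ℝ (fderiv ℝ f) t w v := by
    intro v w
    rw [(hd.hasFDerivAt.clm_apply (hasFDerivAt_const v t)).fderiv]
    simp
  have hs : IsSymmSndFDerivAt ℝ f t := hf.isSymmSndFDerivAt (by
    simp only [minSmoothness_of_isRCLikeNormedField]
    exact WithTop.coe_le_coe.2 (le_top (a := (2 : ℕ∞))))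
  change fderiv ℝ (fun s => fderiv ℝ f s _) t _ = fderiv ℝ (fun s => fderiv ℝ f s _) t _
  rw [key, key]
  exact hs.eq _ _

/-- `pdList` differentiates along the head of the list first, so the last entry is the outermost
derivative. -/
theorem pdList_append_singleton (J : List (Fin n)) (i : Fin n) : ∀ f : Eucl n → F,
    pdList (J ++ [i]) f = pd i (pdList J f) := by
  induction J with
  | nil => intro f; rfl
  | cons j J ih => intro f; exact ih (pd j f)

/-- Equality of germs, not only of values at `0`, is what lets a transposition deep inside the list
survive the later differentiations. -/
theorem pdList_perm {J J' : List (Fin n)} (h : J.Perm J') : ∀ {f : Eucl n → F}, SmoothNear f →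
    pdList J f =ᶠ[𝓝 0] pdList J' f := by
  induction h with
  | nil => intro f _; rfl
  | cons j _ ih => intro f hf; exact ih (hf.pd j)
  | swap i j J =>
    intro f hf
    refine pdList_congr J ?_
    filter_upwards [hf] with t ht using pd_comm ht i j
  | trans _ _ ih ih' => intro f hf; exact (ih hf).trans (ih' hf)

/-- Reconciles the two recursions: in `graphDeriv` the head of the list is the outermost derivative,
in `pdList` the innermost. -/
theorem pdList_cons_eventuallyEq {f : Eucl n → F} (hf : SmoothNear f) (i : Fin n)
    (J : List (Fin n)) : pdList (i :: J) f =ᶠ[𝓝 0] pd i (pdList J f) := by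
  rw [← pdList_append_singleton]
  exact pdList_perm (List.perm_append_singleton i J).symm hf

/-- The multi-index with a given list of entries. -/
def MultiIndex.ofList {r : ℕ} (J : List (Fin n)) (h : J.length ≤ r) : MultiIndex n r :=
  ⟨⟨J.length, by omega⟩, ⟨(J : Multiset (Fin n)), by simp⟩⟩

theorem MultiIndex.list_ofList_perm {r : ℕ} (J : List (Fin n)) (h : J.length ≤ r) :
    (MultiIndex.ofList J h).list.Perm J := by
  rw [← Multiset.coe_eq_coe]
  exact Multiset.sort_eq _ _

theorem MultiIndex.ofList_list {r : ℕ} (J : MultiIndex n r) :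
    (J.list : Multiset (Fin n)) = J.2 := Multiset.sort_eq _ _

theorem MultiIndex.ext_list {r : ℕ} {J J' : MultiIndex n r}
    (h : (J.list : Multiset (Fin n)) = J'.list) : J = J' := by
  rw [J.ofList_list, J'.ofList_list] at h
  obtain ⟨⟨k, hk⟩, J, hJ⟩ := J
  obtain ⟨⟨k', hk'⟩, J', hJ'⟩ := J'
  change J = J' at h
  subst h
  change Multiset.card J = k at hJ
  change Multiset.card J = k' at hJ'
  subst hJ
  subst hJ'
  rfl

/-- `Agree` tests all lists, the jet coordinates only sorted ones; symmetry of partial derivatives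
closes the gap. -/
theorem agree_of_multiIndex {r : ℕ} {f g : Eucl n → F} (hf : SmoothNear f) (hg : SmoothNear g)
    (h : ∀ J : MultiIndex n r, pdList J.list f 0 = pdList J.list g 0) : Agree r f g :=
  fun J hJ => by
    rw [← (pdList_perm (MultiIndex.list_ofList_perm J hJ) hf).self_of_nhds,
      ← (pdList_perm (MultiIndex.list_ofList_perm J hJ) hg).self_of_nhds, h]

theorem pd_coord {N : ℕ} {f : Eucl n → Eucl N} {t : Eucl n} (hf : ContDiffAt ℝ ∞ f t)
    (j : Fin n) (A : Fin N) : pd j (fun s => f s A) t = pd j f t A := by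
  have h := (EuclideanSpace.proj A : Eucl N →L[ℝ] ℝ).hasFDerivAt.comp t
    (hf.differentiableAt (by simp)).hasFDerivAt
  exact DFunLike.congr_fun h.fderiv (EuclideanSpace.single j 1)

theorem pdList_coord {N : ℕ} (A : Fin N) (J : List (Fin n)) : ∀ {f : Eucl n → Eucl N},
    SmoothNear f → pdList J (fun s => f s A) =ᶠ[𝓝 0] fun t => pdList J f t A := by
  induction J with
  | nil => intro f _; rfl
  | cons j J ih =>
    intro f hf
    refine Filter.EventuallyEq.trans (pdList_congr J ?_) (ih (hf.pd j))
    filter_upwards [hf] with t ht using pd_coord ht j A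

theorem pd_const_add (a : F) (f : Eucl n → F) (j : Fin n) :
    pd j (fun t => a + f t) = pd j f := by
  funext t
  simp [pd]

theorem pd_const_smul {f : Eucl n → F} {t : Eucl n} (a : ℝ) (hf : ContDiffAt ℝ ∞ f t)
    (j : Fin n) : pd j (fun t => a • f t) t = a • pd j f t := by
  simp [pd, fderiv_fun_const_smul (hf.differentiableAt (by simp))]

theorem pdList_const_smul (a : ℝ) (J : List (Fin n)) : ∀ {f : Eucl n → F}, SmoothNear f →
    pdList J (fun t => a • f t) =ᶠ[𝓝 0] fun t => a • pdList J f t := by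
  induction J with
  | nil => intro f _; rfl
  | cons j J ih =>
    intro f hf
    refine Filter.EventuallyEq.trans (pdList_congr J ?_) (ih (hf.pd j))
    filter_upwards [hf] with t ht using pd_const_smul a ht j

theorem pdList_sum {ι : Type} (S : Finset ι) (J : List (Fin n)) : ∀ {f : ι → Eucl n → F},
    (∀ i, SmoothNear (f i)) →
    pdList J (fun t => ∑ i ∈ S, f i t) =ᶠ[𝓝 0] fun t => ∑ i ∈ S, pdList J (f i) t := by
  induction J with
  | nil => intro f _; rfl
  | cons j J ih =>
    intro f hf
    refine Filter.EventuallyEq.trans (pdList_congr J ?_) (ih fun i => (hf i).pd j)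
    filter_upwards [(Filter.eventually_all_finset S).2 fun i _ => hf i] with t ht
      using pd_sum S ht j

theorem pd_proj (j k : Fin n) (t : Eucl n) :
    pd j (fun t : Eucl n => t k) t = if k = j then 1 else 0 := by
  have h := (EuclideanSpace.proj k : Eucl n →L[ℝ] ℝ).hasFDerivAt (x := t)
  refine (DFunLike.congr_fun h.fderiv (EuclideanSpace.single j 1)).trans ?_
  simp [eq_comm]

theorem pd_translate (f : Eucl n → F) (s : Eucl n) (j : Fin n) :
    pd j (fun t => f (s + t)) = fun t => pd j f (s + t) := by
  funext t
  simp only [pd, fderiv_comp_add_left]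
end Symmetry

/-! ### Smooth dependence on parameters -/

section Parameters

variable {n N : ℕ} {P F : Type} [NormedAddCommGroup P] [NormedSpace ℝ P]
  [NormedAddCommGroup F] [NormedSpace ℝ F]

/-- Joint smoothness in the parameter and in `t`. The parameter will be the coordinate vector `u` of
a graph, so this yields smoothness of the section of velocities and of the changes of charts. -/
theorem contDiffAt_pd_param {f : P → Eucl n → F} {z : P × Eucl n}
    (hf : ContDiffAt ℝ ∞ (fun z : P × Eucl n => f z.1 z.2) z) (j : Fin n) :
    ContDiffAt ℝ ∞ (fun z : P × Eucl n => pd j (f z.1) z.2) z := by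
  -- The parameter is enlarged to the whole pair `z`, its second half being ignored, so that the
  -- derivative can be evaluated at the point `z.2` that moves with the parameter.
  have h : ContDiffAt ℝ ∞ (Function.uncurry fun w : P × Eucl n => f w.1) (z, z.2) :=
    ContDiffAt.comp (f := fun w : (P × Eucl n) × Eucl n => (w.1.1, w.2)) (z, z.2)
      (g := fun z : P × Eucl n => f z.1 z.2) hf
      (contDiff_fst.fst.prodMk contDiff_snd).contDiffAt
  exact (h.fderiv contDiffAt_snd (m := ∞) (by simp)).clm_apply contDiffAt_const

theorem contDiffAt_pdList_param (J : List (Fin n)) : ∀ {f : P → Eucl n → F} {z : P × Eucl n},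
    ContDiffAt ℝ ∞ (fun z : P × Eucl n => f z.1 z.2) z →
    ContDiffAt ℝ ∞ (fun z : P × Eucl n => pdList J (f z.1) z.2) z := by
  induction J with
  | nil => intro f z h; exact h
  | cons j J ih => intro f z h; exact ih (f := fun p => pd j (f p)) (contDiffAt_pd_param h j)

theorem contDiffAt_pi_pd_param {f : P → Eucl n → F} {z : P × Eucl n}
    (hf : ContDiffAt ℝ ∞ (fun z : P × Eucl n => f z.1 z.2) z) :
    ContDiffAt ℝ ∞ (fun z : P × Eucl n => fun j => pd j (f z.1) z.2) z :=
  contDiffAt_pi.2 fun j => contDiffAt_pd_param hf j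

theorem contDiffAt_det_baseJac_param (I : Fin n ↪o Fin N) {f : P → Eucl n → Eucl N}
    {z : P × Eucl n} (hf : ContDiffAt ℝ ∞ (fun z : P × Eucl n => f z.1 z.2) z) :
    ContDiffAt ℝ ∞ (fun z : P × Eucl n => (baseJac I (f z.1) z.2).det) z :=
  (contDiff_det_entries (contDiff_baseEntries I)).contDiffAt.comp z (contDiffAt_pi_pd_param hf)

theorem contDiffAt_graphDeriv_param (I : Fin n ↪o Fin N) {f : P → Eucl n → Eucl N}
    {z : P × Eucl n} (hf : ContDiffAt ℝ ∞ (fun z : P × Eucl n => f z.1 z.2) z)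
    (h0 : (baseJac I (f z.1) z.2).det ≠ 0) (σ : Fin N) (J : List (Fin n)) :
    ContDiffAt ℝ ∞ (fun z : P × Eucl n => graphDeriv I (f z.1) σ J z.2) z := by
  induction J with
  | nil =>
    exact (EuclideanSpace.proj σ : Eucl N →L[ℝ] ℝ).contDiff.contDiffAt.comp
      z hf
  | cons i J ih =>
    refine ContDiffAt.sum fun j _ => ContDiffAt.mul ?_
      (contDiffAt_pd_param (f := fun p => graphDeriv I (f p) σ J) ih j)
    exact (eventually_contDiffAt_inv I h0 j i).self_of_nhds.comp z (contDiffAt_pi_pd_param hf)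

theorem baseJac_translate (I : Fin n ↪o Fin N) (f : Eucl n → Eucl N) (s t : Eucl n) :
    baseJac I (fun t => f (s + t)) t = baseJac I f (s + t) := by
  ext k j
  simp [baseJac, pd_translate]

/-- The coordinates of `j^r_s f` are defined through the germ of `t ↦ f (s + t)` at `0`; this makes
them the values at `s` of fixed functions, so that they can be differentiated in `s`. -/
theorem graphDeriv_translate (I : Fin n ↪o Fin N) (f : Eucl n → Eucl N) (s : Eucl n)
    (σ : Fin N) (J : List (Fin n)) :
    graphDeriv I (fun t => f (s + t)) σ J = fun t => graphDeriv I f σ J (s + t) := by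
  induction J with
  | nil => rfl
  | cons i J ih =>
    funext t
    simp only [graphDeriv, ih, baseJac_translate, pd_translate]

end Parameters

/-! ### Graphs -/

section NormalForm

variable {n N : ℕ}

/-- The map `f` is, near `0`, the graph of a map in the coordinates `x^{i_k}`, up to a
translation of the parameters. -/
def IsGraphNear (I : Fin n ↪o Fin N) (f : Eucl n → Eucl N) : Prop :=
  ∀ᶠ t in 𝓝 (0 : Eucl n), ∀ k, f t (I k) = f 0 (I k) + t k

theorem IsGraphNear.pd_base {I : Fin n ↪o Fin N} {f : Eucl n → Eucl N} (h : IsGraphNear I f)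
    (j k : Fin n) : pd j (fun t => f t (I k)) =ᶠ[𝓝 0] fun _ => if k = j then 1 else 0 := by
  refine (pd_congr (h.mono fun t ht => ht k) j).trans ?_
  rw [pd_const_add (f 0 (I k)) (fun t : Eucl n => t k) j]
  exact Filter.Eventually.of_forall fun t => pd_proj j k t

theorem IsGraphNear.baseJac_eq {I : Fin n ↪o Fin N} {f : Eucl n → Eucl N} (hf : SmoothNear f)
    (h : IsGraphNear I f) : ∀ᶠ t in 𝓝 (0 : Eucl n), baseJac I f t = 1 := by
  have : ∀ᶠ t in 𝓝 (0 : Eucl n), ∀ k j, pd j (fun t => f t (I k)) t = if k = j then 1 else 0 :=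
    Filter.eventually_all.2 fun k => Filter.eventually_all.2 fun j => h.pd_base j k
  filter_upwards [this, hf] with t h1 h2
  ext k j
  simp [baseJac, ← pd_coord h2, h1, Matrix.one_apply]

/-- The matrix `𝐱` is the identity near `0`, not just at `0`, so the factor `z` disappears at every
stage of the recursion. -/
theorem IsGraphNear.graphDeriv_eq {I : Fin n ↪o Fin N} {f : Eucl n → Eucl N} (hf : SmoothNear f)
    (h : IsGraphNear I f) (σ : Fin N) (J : List (Fin n)) :
    graphDeriv I f σ J =ᶠ[𝓝 0] pdList J (fun t => f t σ) := by
  induction J with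
  | nil => rfl
  | cons i J ih =>
    have hpd : ∀ᶠ t in 𝓝 (0 : Eucl n), ∀ j, pd j (graphDeriv I f σ J) t =
        pd j (pdList J (fun t => f t σ)) t := Filter.eventually_all.2 fun j => pd_congr ih j
    filter_upwards [hpd, h.baseJac_eq hf, pdList_cons_eventuallyEq (hf.coord σ) i J]
      with t h1 h2 h3
    simp [graphDeriv, h1, h2, h3, Matrix.one_apply]

/-- A graph is determined to order `r` by its base point and the functions `y^σ_J`. -/
theorem IsGraphNear.agree {r : ℕ} {I : Fin n ↪o Fin N} {f g : Eucl n → Eucl N}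
    (hf : SmoothNear f) (hg : SmoothNear g) (hfI : IsGraphNear I f) (hgI : IsGraphNear I g)
    (h0 : ∀ k, f 0 (I k) = g 0 (I k))
    (h : ∀ σ, σ ∉ Set.range I → ∀ J : MultiIndex n r,
      graphDeriv I f σ J.list 0 = graphDeriv I g σ J.list 0) : Agree r f g := by
  refine agree_of_multiIndex hf hg fun J => ?_
  ext A
  refine (pdList_coord A J.list hf).self_of_nhds.symm.trans
    (Eq.trans ?_ (pdList_coord A J.list hg).self_of_nhds)
  by_cases hA : A ∈ Set.range I
  · obtain ⟨k, rfl⟩ := hA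
    refine (pdList_congr J.list ?_).self_of_nhds
    filter_upwards [hfI, hgI] with t h1 h2
    rw [h1, h2, h0]
  · rw [← (hfI.graphDeriv_eq hf A J.list).self_of_nhds,
      ← (hgI.graphDeriv_eq hg A J.list).self_of_nhds, h A hA J]

end NormalForm

/-! ### Monomials with prescribed Taylor coefficients -/

section Monomials

variable {n : ℕ}

/-- The monomial `t^{j_1} ⋯ t^{j_k}`. -/
noncomputable def monomialFun (M : Multiset (Fin n)) (t : Eucl n) : ℝ := (M.map fun j => t j).prod

theorem monomialFun_cons (j : Fin n) (M : Multiset (Fin n)) :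
    monomialFun (j ::ₘ M) = fun t => t j * monomialFun M t := by
  funext t
  simp [monomialFun]

theorem contDiff_coord (j : Fin n) : ContDiff ℝ ∞ fun t : Eucl n => t j :=
  (EuclideanSpace.proj j : Eucl n →L[ℝ] ℝ).contDiff

theorem contDiff_monomialFun (M : Multiset (Fin n)) : ContDiff ℝ ∞ (monomialFun M) := by
  induction M using Multiset.induction with
  | empty => exact contDiff_const (c := (1 : ℝ))
  | cons j M ih =>
    rw [monomialFun_cons]
    exact (contDiff_coord j).mul ih

theorem pd_mul {f g : Eucl n → ℝ} {t : Eucl n} (hf : ContDiffAt ℝ ∞ f t)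
    (hg : ContDiffAt ℝ ∞ g t) (j : Fin n) :
    pd j (fun t => f t * g t) t = f t * pd j g t + g t * pd j f t := by
  simp [pd, fderiv_fun_mul (hf.differentiableAt (by simp)) (hg.differentiableAt (by simp))]

/-- The power rule with the multiplicity as exponent. If `i` does not occur, the coefficient is `0`
and the unchanged `M.erase i` does no harm. -/
theorem pd_monomialFun (i : Fin n) (M : Multiset (Fin n)) :
    pd i (monomialFun M) = fun t => (M.count i : ℝ) • monomialFun (M.erase i) t := by
  induction M using Multiset.induction with
  | empty =>
    funext t
    have : monomialFun (0 : Multiset (Fin n)) = fun _ => 1 := rfl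
    simp [this, pd]
  | cons j M ih =>
    funext t
    rw [monomialFun_cons, pd_mul (contDiff_coord j).contDiffAt (contDiff_monomialFun M).contDiffAt,
      ih, pd_proj]
    by_cases h : j = i
    · subst h
      by_cases hj : j ∈ M
      · have := congrFun (monomialFun_cons j (M.erase j)) t
        rw [Multiset.cons_erase hj] at this
        simp only [this, Multiset.count_cons_self, Multiset.erase_cons_head, smul_eq_mul, if_true]
        push_cast
        ring
      · simp [hj]
    · rw [Multiset.erase_cons_tail _ h, monomialFun_cons, Multiset.count_cons_of_ne (Ne.symm h)]
      simp only [h, if_false, smul_eq_mul]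
      ring

/-- Each derivative removes one matching factor or kills the monomial, and a factor left over
vanishes at `0`. Non-vanishing is enough here, since `jetMonomial` divides by the value, so the
factorials need not be computed. -/
theorem pdList_monomialFun_ne_zero_iff (J : List (Fin n)) : ∀ M : Multiset (Fin n),
    pdList J (monomialFun M) 0 ≠ 0 ↔ M = J := by
  induction J with
  | nil =>
    intro M
    induction M using Multiset.induction with
    | empty => simp [pdList, monomialFun]
    | cons j M _ => simp [pdList, monomialFun_cons]
  | cons i J ih =>
    intro M
    change pdList J (pd i (monomialFun M)) 0 ≠ 0 ↔ _
    have e : pdList J (fun t => (M.count i : ℝ) • monomialFun (M.erase i) t) 0 =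
        (M.count i : ℝ) * pdList J (monomialFun (M.erase i)) 0 :=
        (pdList_const_smul (M.count i : ℝ) J (f := monomialFun (M.erase i))
      (Filter.Eventually.of_forall fun t => (contDiff_monomialFun _).contDiffAt)).self_of_nhds
    rw [pd_monomialFun, e, mul_ne_zero_iff, ih, Nat.cast_ne_zero, ← Nat.pos_iff_ne_zero,
      Multiset.count_pos, ← Multiset.cons_coe]
    constructor
    · rintro ⟨h1, h2⟩
      rw [← h2, Multiset.cons_erase h1]
    · rintro rfl
      simp

/-- The monomial whose only non-zero derivative at `0` is the `J`-th, which is `1`. -/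
noncomputable def jetMonomial {r : ℕ} (J : MultiIndex n r) (t : Eucl n) : ℝ :=
  (pdList J.list (monomialFun (J.list : Multiset (Fin n))) 0)⁻¹ •
    monomialFun (J.list : Multiset (Fin n)) t

theorem contDiff_jetMonomial {r : ℕ} (J : MultiIndex n r) : ContDiff ℝ ∞ (jetMonomial J) :=
  (contDiff_monomialFun _).const_smul _

theorem pdList_jetMonomial {r : ℕ} (J K : MultiIndex n r) :
    pdList J.list (jetMonomial K) 0 = if K = J then 1 else 0 := by
  refine (pdList_const_smul _ J.list (Filter.Eventually.of_forall
    fun t => (contDiff_monomialFun _).contDiffAt)).self_of_nhds.trans ?_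
  split_ifs with h
  · subst h
    exact inv_mul_cancel₀ ((pdList_monomialFun_ne_zero_iff _ _).2 rfl)
  · have : pdList J.list (monomialFun (K.list : Multiset (Fin n))) 0 = 0 := by
      by_contra h0
      exact h (MultiIndex.ext_list ((pdList_monomialFun_ne_zero_iff _ _).1 h0))
    simp [this]

end Monomials


/-! ### Graphs with prescribed coordinates -/

section Assemble

variable {n N : ℕ} (I : Fin n ↪o Fin N)

open Classical in
/-- The point of `ℝᴺ` with given components in and outside the range of `I`. -/
noncomputable def assemble :
    ((Fin n → ℝ) × ({σ : Fin N // σ ∉ Set.range I} → ℝ)) →L[ℝ] Eucl N :=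
  LinearMap.toContinuousLinearMap
    { toFun := fun z => WithLp.toLp 2 fun A =>
        if h : A ∈ Set.range I then z.1 h.choose else z.2 ⟨A, h⟩
      map_add' := fun z w => by
        ext A
        change dite _ (fun h => z.1 _ + w.1 _) (fun h => z.2 _ + w.2 _) =
          (dite _ (fun h => z.1 _) fun h => z.2 _) + dite _ (fun h => w.1 _) fun h => w.2 _
        split_ifs <;> rfl
      map_smul' := fun a z => by
        ext A
        change dite _ (fun h => a * z.1 _) (fun h => a * z.2 _) =
          a * dite _ (fun h => z.1 _) fun h => z.2 _
        split_ifs <;> rfl }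

theorem assemble_base (z : (Fin n → ℝ) × ({σ : Fin N // σ ∉ Set.range I} → ℝ)) (k : Fin n) :
    assemble I z (I k) = z.1 k := by
  have h : I k ∈ Set.range I := ⟨k, rfl⟩
  have e : h.choose = k := I.injective h.choose_spec
  change (if h : I k ∈ Set.range I then z.1 h.choose else z.2 ⟨I k, h⟩) = _
  rw [dif_pos h, e]

theorem assemble_fiber (z : (Fin n → ℝ) × ({σ : Fin N // σ ∉ Set.range I} → ℝ))
    (σ : {σ : Fin N // σ ∉ Set.range I}) : assemble I z σ = z.2 σ := by
  change (if h : σ.1 ∈ Set.range I then z.1 h.choose else z.2 ⟨σ.1, h⟩) = _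
  rw [dif_neg σ.2]

variable {I}

theorem eucl_ext {v w : Eucl N} (h : ∀ k, v (I k) = w (I k))
    (h' : ∀ σ : {σ : Fin N // σ ∉ Set.range I}, v σ = w σ) : v = w := by
  ext A
  by_cases hA : A ∈ Set.range I
  · obtain ⟨k, rfl⟩ := hA
    exact h k
  · exact h' ⟨A, hA⟩

end Assemble

/-! ### Polynomial graphs and the projected total derivatives `E_i` -/

section GraphMap

variable {n N r : ℕ} {X : Type*} [TopologicalSpace X] [ChartedSpace (Eucl N) X]

/-- The base point `(x^i, y^σ)`, as a point of `ℝᴺ`, of the point with coordinates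
`(x^i, y^σ_J)`. -/
noncomputable def AdaptedChart.basePt (c : AdaptedChart n N X) (r : ℕ) :
    c.Model r →L[ℝ] Eucl N :=
  (assemble c.I).comp ((ContinuousLinearMap.fst ℝ (Fin n → ℝ)
      ({σ : Fin N // σ ∉ Set.range c.I} → MultiIndex n r → ℝ)).prod
    (ContinuousLinearMap.pi fun σ =>
      ((ContinuousLinearMap.proj (R := ℝ) (φ := fun _ : MultiIndex n r => ℝ)
        (MultiIndex.ofList [] (Nat.zero_le r))).comp
        (ContinuousLinearMap.proj (R := ℝ)
          (φ := fun _ : {σ : Fin N // σ ∉ Set.range c.I} => MultiIndex n r → ℝ) σ)).comp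
        (ContinuousLinearMap.snd ℝ (Fin n → ℝ) _)))

/-- The graph with coordinates `u`. -/
noncomputable def AdaptedChart.graphMap (c : AdaptedChart n N X) (u : c.Model r) (t : Eucl n) :
    Eucl N :=
  assemble c.I (u.1 + t.ofLp, fun σ => ∑ J, u.2 σ J * jetMonomial J t)

variable (c : AdaptedChart n N X) (u : c.Model r)

theorem AdaptedChart.basePt_base (k : Fin n) : c.basePt r u (c.I k) = u.1 k :=
  assemble_base _ _ k

theorem AdaptedChart.basePt_fiber (σ : {σ : Fin N // σ ∉ Set.range c.I}) :
    c.basePt r u σ = u.2 σ (MultiIndex.ofList [] (Nat.zero_le r)) :=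
  assemble_fiber _ _ σ

theorem AdaptedChart.graphMap_base (t : Eucl n) (k : Fin n) :
    c.graphMap u t (c.I k) = u.1 k + t k :=
  assemble_base _ _ k

theorem AdaptedChart.graphMap_fiber (t : Eucl n) (σ : {σ : Fin N // σ ∉ Set.range c.I}) :
    c.graphMap u t σ = ∑ J, u.2 σ J * jetMonomial J t :=
  assemble_fiber _ _ σ

theorem AdaptedChart.contDiff_graphMap :
    ContDiff ℝ ∞ fun z : c.Model r × Eucl n => c.graphMap z.1 z.2 := by
  refine (assemble c.I).contDiff.comp (ContDiff.prodMk ?_ (contDiff_pi.2 fun σ => ?_))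
  · exact contDiff_fst.fst.add ((EuclideanSpace.equiv (Fin n) ℝ).contDiff.comp contDiff_snd)
  · refine ContDiff.sum fun J _ => ContDiff.mul ?_ ((contDiff_jetMonomial J).comp contDiff_snd)
    exact ((ContinuousLinearMap.proj (R := ℝ) (φ := fun _ : MultiIndex n r => ℝ) J).comp
      (ContinuousLinearMap.proj (R := ℝ)
        (φ := fun _ : {σ : Fin N // σ ∉ Set.range c.I} => MultiIndex n r → ℝ) σ)).contDiff.comp
      contDiff_fst.snd

theorem AdaptedChart.contDiff_graphMap_right : ContDiff ℝ ∞ (c.graphMap u) :=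
  c.contDiff_graphMap.comp (contDiff_const.prodMk contDiff_id)

theorem AdaptedChart.smoothNear_graphMap : SmoothNear (c.graphMap u) :=
  Filter.Eventually.of_forall fun _ => (c.contDiff_graphMap_right u).contDiffAt

theorem AdaptedChart.isGraphNear_graphMap : IsGraphNear c.I (c.graphMap u) :=
  Filter.Eventually.of_forall fun t k => by simp [c.graphMap_base]

/-- The functions `jetMonomial` are dual to the derivatives at `0`, so the coefficients are
recovered. -/
theorem AdaptedChart.pdList_graphMap (σ : {σ : Fin N // σ ∉ Set.range c.I})
    (J : MultiIndex n r) : pdList J.list (fun t => c.graphMap u t σ) 0 = u.2 σ J := by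
  have hs : ∀ K : MultiIndex n r, SmoothNear (jetMonomial K) := fun K =>
    Filter.Eventually.of_forall fun _ => (contDiff_jetMonomial K).contDiffAt
  have e : (fun t => c.graphMap u t σ) = fun t => ∑ K, u.2 σ K • jetMonomial K t := by
    funext t
    exact c.graphMap_fiber u t σ
  have h2 : ∀ K, pdList J.list (fun t => u.2 σ K • jetMonomial K t) 0 =
      u.2 σ K • pdList J.list (jetMonomial K) 0 := fun K =>
    (pdList_const_smul (u.2 σ K) J.list (hs K)).self_of_nhds
  have h1 := (pdList_sum Finset.univ J.list (f := fun K t => u.2 σ K • jetMonomial K t)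
    fun K => Filter.Eventually.of_forall fun _ =>
      ((contDiff_jetMonomial K).const_smul _).contDiffAt).self_of_nhds
  rw [e, h1]
  change ∑ K, pdList J.list (fun t => u.2 σ K • jetMonomial K t) 0 = _
  rw [Finset.sum_congr rfl fun K _ => h2 K]
  simp [pdList_jetMonomial]

theorem AdaptedChart.graphDeriv_graphMap (σ : {σ : Fin N // σ ∉ Set.range c.I})
    (J : MultiIndex n r) : graphDeriv c.I (c.graphMap u) σ J.list 0 = u.2 σ J := by
  rw [((c.isGraphNear_graphMap u).graphDeriv_eq (c.smoothNear_graphMap u) σ J.list).self_of_nhds,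
    c.pdList_graphMap]

theorem AdaptedChart.baseJac_graphMap : baseJac c.I (c.graphMap u) 0 = 1 :=
  ((c.isGraphNear_graphMap u).baseJac_eq (c.smoothNear_graphMap u)).self_of_nhds

theorem MultiIndex.list_nil : (MultiIndex.ofList [] (Nat.zero_le r) : MultiIndex n r).list = [] :=
  List.perm_nil.1 (MultiIndex.list_ofList_perm _ _)

theorem AdaptedChart.graphMap_zero : c.graphMap u 0 = c.basePt r u := by
  refine eucl_ext (I := c.I) (fun k => ?_) fun σ => ?_
  · simp [c.graphMap_base, c.basePt_base]
  · rw [c.basePt_fiber, ← c.pdList_graphMap, MultiIndex.list_nil]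
    rfl

theorem AdaptedChart.basePt_totalVec_base (i k : Fin n) :
    c.basePt r (c.totalVec i u) (c.I k) = if k = i then 1 else 0 := by
  rw [c.basePt_base]
  simp [AdaptedChart.totalVec, Pi.single_apply]

theorem AdaptedChart.basePt_totalVec_fiber [NeZero r] (i : Fin n)
    (σ : {σ : Fin N // σ ∉ Set.range c.I}) :
    c.basePt r (c.totalVec i u) σ = u.2 σ (MultiIndex.ofList [i] NeZero.one_le) := by
  rw [c.basePt_fiber]
  -- This is where `r ≥ 1` matters: the empty multi-index lies below the cut-off `|J| ≤ r - 1` of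
  -- the total derivative, so `E_i` has the fibre components `y^σ_i`.
  have h : ((MultiIndex.ofList [] (Nat.zero_le r) : MultiIndex n r).1 : ℕ) + 1 < r + 1 := by
    have := NeZero.ne r
    simp only [MultiIndex.ofList, List.length_nil]
    omega
  simp only [AdaptedChart.totalVec, dif_pos h]
  congr 1

/-- The derivatives of a map in terms of its graph coordinates: `∂_l f = x^j_l E_j`, where `E_j` is
the projection of the total derivative `D_j` to `ℝᴺ`. -/
theorem AdaptedChart.pd_eq_sum_totalVec [NeZero r] {f : Eucl n → Eucl N} (hf : ContDiffAt ℝ ∞ f 0)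
    (h0 : (baseJac c.I f 0).det ≠ 0)
    (hu : ∀ (σ : {σ : Fin N // σ ∉ Set.range c.I}) (J : MultiIndex n r),
      u.2 σ J = graphDeriv c.I f σ J.list 0) (l : Fin n) :
    pd l f 0 = ∑ j, baseJac c.I f 0 j l • c.basePt r (c.totalVec j u) := by
  refine eucl_ext (I := c.I) (fun k => ?_) fun σ => ?_
  · simp only [WithLp.ofLp_sum, WithLp.ofLp_smul, Finset.sum_apply, Pi.smul_apply,
      c.basePt_totalVec_base, smul_eq_mul, mul_ite, mul_one, mul_zero]
    simp [baseJac]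
  · have hl : ∀ j : Fin n, (MultiIndex.ofList [j] NeZero.one_le : MultiIndex n r).list = [j] :=
      fun j => List.perm_singleton.1 (MultiIndex.list_ofList_perm _ _)
    simp only [WithLp.ofLp_sum, WithLp.ofLp_smul, Finset.sum_apply, Pi.smul_apply,
      c.basePt_totalVec_fiber, hu, hl, smul_eq_mul, graphDeriv, Finset.mul_sum]
    rw [Finset.sum_comm]
    have hB : (baseJac c.I f 0)⁻¹ * baseJac c.I f 0 = 1 :=
      Matrix.nonsing_inv_mul _ (isUnit_iff_ne_zero.2 h0)
    -- Since `y^σ_j = z^m_j ∂_m f^σ`, contraction with `x^j_l` cancels `z` against `𝐱`.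
    have key : ∀ m, ∑ j, baseJac c.I f 0 j l * ((baseJac c.I f 0)⁻¹ m j *
        pd m (fun t => f t σ) 0) = (if m = l then 1 else 0) * pd m f 0 σ := by
      intro m
      rw [← Matrix.one_apply, ← hB, Matrix.mul_apply, Finset.sum_mul, pd_coord hf]
      exact Finset.sum_congr rfl fun j _ => by ring
    simp [key]

end GraphMap

/-! ### The section of velocities given by graphs -/

section Section

variable {n N r : ℕ} {X : Type*} [TopologicalSpace X] [ChartedSpace (Eucl N) X]

/-- The components `x^{i_k}` of the derivative return the argument itself. -/
theorem AdaptedChart.injective_fderiv_graphMap (c : AdaptedChart n N X) (u : c.Model r)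
    (t : Eucl n) : Function.Injective (fderiv ℝ (c.graphMap u) t) := by
  have hd := ((c.contDiff_graphMap_right u).differentiable (by simp) t).hasFDerivAt
  intro v w hvw
  ext k
  have hk := (EuclideanSpace.proj (c.I k) : Eucl N →L[ℝ] ℝ).hasFDerivAt.comp t hd
  have hk' : HasFDerivAt (fun t : Eucl n => u.1 k + t k) (EuclideanSpace.proj k : Eucl n →L[ℝ] ℝ)
      t := (EuclideanSpace.proj k : Eucl n →L[ℝ] ℝ).hasFDerivAt.const_add (u.1 k)
  have e : (⇑(EuclideanSpace.proj (c.I k) : Eucl N →L[ℝ] ℝ) ∘ c.graphMap u) =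
      fun t : Eucl n => u.1 k + t k := by
    funext t
    exact c.graphMap_base u t k
  rw [e] at hk
  have h := hk.unique hk'
  have hv := DFunLike.congr_fun h v
  have hw := DFunLike.congr_fun h w
  simp only [ContinuousLinearMap.comp_apply, hvw] at hv hw
  exact hv.symm.trans hw

/-- The germ of immersion whose local expression is the graph with coordinates `u`. -/
noncomputable def AdaptedChart.sectionGerm (c : AdaptedChart n N X) (u : c.Model r)
    (hu : c.basePt r u ∈ c.ψ.1.target) : ImmersionGerm n N X where
  toFun t := c.ψ.1.symm (c.graphMap u t)
  immersive := by
    have hc : ContinuousAt (c.graphMap u) 0 := (c.contDiff_graphMap_right u).continuous.continuousAt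
    have ht : ∀ᶠ t in 𝓝 (0 : Eucl n), c.graphMap u t ∈ c.ψ.1.target :=
      hc.eventually (c.ψ.1.open_target.mem_nhds (by rwa [c.graphMap_zero]))
    -- The graph must stay in the image of `ψ` around each nearby `t`, because the identity `ψ ∘ ψ⁻¹
    -- ∘ graph = graph` gets differentiated at `t`.
    filter_upwards [ht.eventually_nhds] with t ht
    have hg : ContMDiffAt (𝓡 n) (𝓡 N) ∞ (c.graphMap u) t :=
      (c.contDiff_graphMap_right u).contDiffAt.contMDiffAt
    have hs : ContMDiffAt (𝓡 n) (𝓡 N) ∞ (fun t => c.ψ.1.symm (c.graphMap u t)) t :=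
      (contMDiffAt_symm_of_mem_maximalAtlas c.ψ.2 ht.self_of_nhds).comp t hg
    have hψ : ContMDiffAt (𝓡 N) (𝓡 N) ∞ c.ψ.1 (c.ψ.1.symm (c.graphMap u t)) :=
      contMDiffAt_of_mem_maximalAtlas c.ψ.2 (c.ψ.1.map_target ht.self_of_nhds)
    refine ⟨hs, ?_⟩
    have e : mfderiv (𝓡 n) (𝓡 N) (c.graphMap u) t =
        (mfderiv (𝓡 N) (𝓡 N) c.ψ.1 (c.ψ.1.symm (c.graphMap u t))).comp
          (mfderiv (𝓡 n) (𝓡 N) (fun t => c.ψ.1.symm (c.graphMap u t)) t) := by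
      rw [← mfderiv_comp t (hψ.mdifferentiableAt (by simp)) (hs.mdifferentiableAt (by simp))]
      refine Filter.EventuallyEq.mfderiv_eq ?_
      filter_upwards [ht] with s hs
      exact (c.ψ.1.right_inv hs).symm
    have hi : Function.Injective (mfderiv (𝓡 n) (𝓡 N) (c.graphMap u) t) := by
      rw [mfderiv_eq_fderiv]
      exact c.injective_fderiv_graphMap u t
    rw [e] at hi
    -- The inner factor of an injective composite is injective.
    exact Function.Injective.of_comp (f := mfderiv (𝓡 N) (𝓡 N) c.ψ.1 _) hi

variable (c : AdaptedChart n N X) (u : c.Model r) (hu : c.basePt r u ∈ c.ψ.1.target)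

theorem AdaptedChart.sectionGerm_zero :
    (c.sectionGerm u hu).toFun 0 = c.ψ.1.symm (c.basePt r u) := by
  rw [← c.graphMap_zero]
  rfl

theorem AdaptedChart.sectionGerm_mem : (c.sectionGerm u hu).toFun 0 ∈ c.ψ.1.source := by
  rw [c.sectionGerm_zero]
  exact c.ψ.1.map_target hu

theorem AdaptedChart.expr_sectionGerm :
    c.expr (c.sectionGerm u hu) =ᶠ[𝓝 0] c.graphMap u := by
  have hc : ContinuousAt (c.graphMap u) 0 := (c.contDiff_graphMap_right u).continuous.continuousAt
  filter_upwards [hc.eventually (c.ψ.1.open_target.mem_nhds (by rwa [c.graphMap_zero]))] with t ht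
    using c.ψ.1.right_inv ht

theorem baseJac_congr (I : Fin n ↪o Fin N) {f g : Eucl n → Eucl N} {t : Eucl n}
    (h : f =ᶠ[𝓝 t] g) : baseJac I f =ᶠ[𝓝 t] baseJac I g := by
  have : ∀ᶠ s in 𝓝 t, ∀ j, pd j f s = pd j g s := Filter.eventually_all.2 fun j => pd_congr h j
  filter_upwards [this] with s hs
  ext k j
  simp [baseJac, hs]

theorem graphDeriv_congr (I : Fin n ↪o Fin N) {f g : Eucl n → Eucl N} {t : Eucl n}
    (h : f =ᶠ[𝓝 t] g) (σ : Fin N) (J : List (Fin n)) :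
    graphDeriv I f σ J =ᶠ[𝓝 t] graphDeriv I g σ J := by
  induction J with
  | nil => exact h.mono fun s hs => congrArg (fun v : Eucl N => v σ) hs
  | cons i J ih =>
    have : ∀ᶠ s in 𝓝 t, ∀ j, pd j (graphDeriv I f σ J) s = pd j (graphDeriv I g σ J) s :=
      Filter.eventually_all.2 fun j => pd_congr ih j
    filter_upwards [this, baseJac_congr I h] with s h1 h2
    simp [graphDeriv, h1, h2]

theorem AdaptedChart.good_sectionGerm : c.Good (c.sectionGerm u hu) := by
  refine ⟨c.sectionGerm_mem u hu, ?_⟩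
  rw [(baseJac_congr c.I (c.expr_sectionGerm u hu)).self_of_nhds, c.baseJac_graphMap]
  simp

variable [IsManifold (𝓡 N) ∞ X] [NeZero r]

theorem AdaptedChart.coord_mk_of_good {c : AdaptedChart n N X} {γ : ImmersionGerm n N X}
    (h : c.Good γ) : c.coord (Velocity.proj (Quotient.mk (jetSetoid n N r X) γ)) =
      ((fun i => c.expr γ 0 (c.I i),
        fun σ (J : MultiIndex n r) => graphDeriv c.I (c.expr γ) σ J.list 0) : c.Model r) :=
  if_pos h

theorem AdaptedChart.detX_mk_of_good {c : AdaptedChart n N X} {γ : ImmersionGerm n N X}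
    (h : c.Good γ) : c.detX (Quotient.mk (jetSetoid n N r X) γ) =
      (baseJac c.I (c.expr γ) 0).det :=
  if_pos h

/-- The regular velocity of the graph with coordinates `u`. -/
noncomputable def AdaptedChart.section (c : AdaptedChart n N X) (u : c.Model r)
    (hu : c.basePt r u ∈ c.ψ.1.target) : Velocity n N r X :=
  Quotient.mk (jetSetoid n N r X) (c.sectionGerm u hu)

theorem AdaptedChart.section_mem_velDomain : c.section u hu ∈ c.velDomain :=
  c.good_sectionGerm u hu

theorem AdaptedChart.proj_section_mem_domain : (c.section u hu).proj ∈ c.domain :=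
  ⟨_, c.section_mem_velDomain u hu, rfl⟩

/-- Graphs realize all coordinate values over the image of `ψ`. With
`AdaptedChart.proj_section_coord` this makes `coord` a bijection from `ρ(W)` onto its image, the
section composed with `ρ` being the inverse. -/
theorem AdaptedChart.coord_section : c.coord (c.section u hu).proj = u := by
  have h := c.expr_sectionGerm u hu
  refine (AdaptedChart.coord_mk_of_good (c.good_sectionGerm u hu)).trans (Prod.ext ?_ ?_)
  · funext i
    simp [h.self_of_nhds, c.graphMap_base]
  · funext σ J
    rw [← c.graphDeriv_graphMap u σ J]
    exact (graphDeriv_congr c.I h σ J.list).self_of_nhds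

theorem AdaptedChart.basePt_coord {c : AdaptedChart n N X} {γ : ImmersionGerm n N X}
    (h : c.Good γ) :
    c.basePt r (c.coord (Velocity.proj (Quotient.mk (jetSetoid n N r X) γ))) = c.expr γ 0 := by
  rw [AdaptedChart.coord_mk_of_good h]
  refine eucl_ext (I := c.I) (fun k => ?_) fun σ => ?_
  · rw [c.basePt_base]
  · rw [c.basePt_fiber]
    change graphDeriv c.I (c.expr γ) σ (MultiIndex.ofList [] (Nat.zero_le r)).list 0 = _
    rw [MultiIndex.list_nil]
    rfl

/-- Reparametrization of an immersion by its coordinates `x^{i_k}`. -/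
theorem exists_reparam_isGraphNear (I : Fin n ↪o Fin N) {f : Eucl n → Eucl N} (hf : SmoothNear f)
    (h0 : (baseJac I f 0).det ≠ 0) :
    ∃ α : ReparamGerm n, IsGraphNear I (fun t => f (α.toFun t)) ∧
      (jac α.toFun 0).det = (baseJac I f 0).det⁻¹ := by
  -- The selected coordinates, translated to fix `0`; the reparametrization sought is the local
  -- inverse of `h`.
  let h : Eucl n → Eucl n := fun t => WithLp.toLp 2 fun k => f t (I k) - f 0 (I k)
  have hh : SmoothNear h := by
    filter_upwards [hf] with t ht
    exact contDiffAt_euclidean.2 fun k =>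
      ((EuclideanSpace.proj (I k) : Eucl N →L[ℝ] ℝ).contDiff.contDiffAt.comp t ht).sub
        contDiffAt_const
  have hj : ∀ᶠ t in 𝓝 (0 : Eucl n), jac h t = baseJac I f t := by
    filter_upwards [hf, hh] with t h1 h2
    ext k j
    have e : (fun s => h s k) = fun s => -f 0 (I k) + f s (I k) := by
      funext s
      simp only [h]
      ring
    simp only [jac, baseJac, Matrix.of_apply, ← pd_coord h1, ← pd_coord h2]
    rw [e, pd_const_add (-f 0 (I k)) (fun s => f s (I k)) j]
  have hdet : (jac h 0).det ≠ 0 := by rwa [hj.self_of_nhds]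
  -- Needed at `0` for the inverse function theorem and at all nearby points for smoothness of the
  -- inverse on a neighbourhood.
  have hinv : ∀ t, (jac h t).det ≠ 0 → ContDiffAt ℝ ∞ h t →
      ∃ e : Eucl n ≃L[ℝ] Eucl n, HasFDerivAt h (e : Eucl n →L[ℝ] Eucl n) t := by
    intro t h1 h2
    refine ⟨(LinearEquiv.ofInjectiveEndo (fderiv ℝ h t : Eucl n →ₗ[ℝ] Eucl n)
      (fderiv_injective h1)).toContinuousLinearEquiv, ?_⟩
    exact (h2.differentiableAt (by simp)).hasFDerivAt
  obtain ⟨e, he⟩ := hinv 0 hdet hh.self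
  let φ := hh.self.toOpenPartialHomeomorph h he (by simp)
  have hφ : ⇑φ = h := rfl
  have hh0 : h 0 = 0 := by
    ext k
    simp [h]
  have h0s : (0 : Eucl n) ∈ φ.source :=
    ContDiffAt.mem_toOpenPartialHomeomorph_source hh.self he (by simp)
  have h0t : (0 : Eucl n) ∈ φ.target := by
    have := φ.map_source h0s
    rwa [hφ, hh0] at this
  have hs0 : φ.symm 0 = 0 := by
    have := φ.left_inv h0s
    rwa [hφ, hh0] at this
  have hcs : Filter.Tendsto φ.symm (𝓝 0) (𝓝 0) := by
    have := φ.continuousAt_symm h0t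
    rwa [ContinuousAt, hs0] at this
  have hsm : SmoothNear φ.symm := by
    filter_upwards [φ.open_target.mem_nhds h0t, hcs.eventually hh,
      hcs.eventually (eventually_jac_ne hh hdet)] with t h1 h2 h3
    obtain ⟨e', he'⟩ := hinv _ h3 h2
    exact φ.contDiffAt_symm h1 he' h2
  have hgr : IsGraphNear I (fun t => f (φ.symm t)) := by
    filter_upwards [φ.open_target.mem_nhds h0t] with t ht k
    have := congrArg (fun v : Eucl n => v k) (φ.right_inv ht)
    simp only [hφ, h] at this
    simp only [hs0]
    linarith
  have hfc : SmoothNear (fun t => f (φ.symm t)) := hf.comp_right hsm hs0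
  -- The matrix `𝐱` of the reparametrized map is `1` because that map is a graph; by the chain rule
  -- it is also the product on the left.
  have hJ : baseJac I f 0 * jac φ.symm 0 = 1 := by
    rw [← (hgr.baseJac_eq hfc).self_of_nhds, baseJac_comp I (by rw [hs0]; exact hf.self) hsm.self,
      hs0]
  have hJd : (baseJac I f 0).det * (jac φ.symm 0).det = 1 := by
    rw [← Matrix.det_mul, hJ, Matrix.det_one]
  exact ⟨⟨φ.symm, hs0, hsm, fun h => by simp [h] at hJd⟩, hgr, eq_inv_of_mul_eq_one_right hJd⟩

theorem AdaptedChart.basePt_coord_mem {c : AdaptedChart n N X} {p : Grassmannian n N r X}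
    (hp : p ∈ c.domain) : c.basePt r (c.coord p) ∈ c.ψ.1.target := by
  obtain ⟨x, hx, rfl⟩ := hp
  induction x using Quotient.inductionOn with | _ γ
  rw [AdaptedChart.basePt_coord hx]
  exact c.ψ.1.map_source hx.1

/-- Every velocity in `W` can be reparametrized to the velocity of a graph. -/
theorem AdaptedChart.exists_act_eq_section {c : AdaptedChart n N X} {x : Velocity n N r X}
    (hx : x ∈ c.velDomain) (hu : c.basePt r (c.coord x.proj) ∈ c.ψ.1.target) :
    ∃ a : DiffGroup n r, x.act a = c.section (c.coord x.proj) hu ∧ a.det = (c.detX x)⁻¹ := by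
  induction x using Quotient.inductionOn with | _ γ
  have hγ : c.Good γ := hx
  have hf : SmoothNear (c.expr γ) := smoothNear_chart γ c.ψ.2 hγ.1
  obtain ⟨α, hα, hdet⟩ := exists_reparam_isGraphNear c.I hf hγ.2
  have hcoord : c.coord (Velocity.proj (Quotient.mk (jetSetoid n N r X) (γ.comp α))) =
      c.coord (Velocity.proj (Quotient.mk (jetSetoid n N r X) γ)) :=
    congrArg c.coord (Quot.sound ⟨Quotient.mk (reparamSetoid n r) α, rfl⟩).symm
  have hgc : c.Good (γ.comp α) := (c.good_comp γ α).2 hγ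
  have hcc := AdaptedChart.coord_mk_of_good (r := r) hgc
  rw [hcoord] at hcc
  refine ⟨Quotient.mk (reparamSetoid n r) α, ?_, ?_⟩
  · set u := c.coord (Velocity.proj (Quotient.mk (jetSetoid n N r X) γ)) with hudef
    have h0 : c.basePt r u = c.expr γ 0 := AdaptedChart.basePt_coord hγ
    -- The action does not change the coordinates `(x^i, y^σ_J)`, so both maps are graphs with the
    -- coordinates `u`, and graphs are determined to order `r` by them.
    have hagree : Agree r (c.expr (γ.comp α)) (c.graphMap u) := by
      refine IsGraphNear.agree (I := c.I) (smoothNear_chart _ c.ψ.2 hgc.1)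
        (c.smoothNear_graphMap u) hα (c.isGraphNear_graphMap u) (fun k => ?_) fun σ hσ J => ?_
      · rw [c.graphMap_zero, c.basePt_base, hcc]
      · rw [c.graphDeriv_graphMap u ⟨σ, hσ⟩, hcc]
    refine Quotient.sound ⟨?_, c.ψ.1, c.ψ.2, hgc.1, ?_⟩
    · rw [c.sectionGerm_zero, h0, γ.comp_zero]
      exact (c.ψ.1.left_inv hγ.1).symm
    · exact hagree.of_eventuallyEq Filter.EventuallyEq.rfl (c.expr_sectionGerm u hu)
  · rw [AdaptedChart.detX_mk_of_good hγ]
    exact hdet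

/-- A point of `ρ(W)` is determined by its coordinates. -/
theorem AdaptedChart.proj_section_coord {c : AdaptedChart n N X} {p : Grassmannian n N r X}
    (hp : p ∈ c.domain) (hu : c.basePt r (c.coord p) ∈ c.ψ.1.target) :
    (c.section (c.coord p) hu).proj = p := by
  obtain ⟨x, hx, rfl⟩ := hp
  obtain ⟨a, ha, -⟩ := AdaptedChart.exists_act_eq_section hx hu
  rw [← ha]
  exact (Quot.sound ⟨a, rfl⟩).symm

theorem AdaptedChart.coord_injOn (c : AdaptedChart n N X) :
    Set.InjOn c.coord (c.domain : Set (Grassmannian n N r X)) := fun p hp q hq h => by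
  rw [← AdaptedChart.proj_section_coord hp (AdaptedChart.basePt_coord_mem hp),
    ← AdaptedChart.proj_section_coord hq (AdaptedChart.basePt_coord_mem hq)]
  congr 2

/-- Only the base point is constrained; the `y^σ_J` with `|J| ≥ 1` are free. In particular the image
is open. -/
theorem AdaptedChart.coord_image_domain (c : AdaptedChart n N X) :
    c.coord '' (c.domain : Set (Grassmannian n N r X)) = c.basePt r ⁻¹' c.ψ.1.target := by
  ext u
  constructor
  · rintro ⟨p, hp, rfl⟩
    exact AdaptedChart.basePt_coord_mem hp
  · intro hu
    exact ⟨_, c.proj_section_mem_domain u hu, c.coord_section u hu⟩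

theorem AdaptedChart.mem_velDomain_of_proj_mem {c : AdaptedChart n N X} {x : Velocity n N r X}
    (h : x.proj ∈ c.domain) : x ∈ c.velDomain := by
  obtain ⟨y, hy, hxy⟩ := h
  -- `W` is stable under the group, so membership in `W` descends to the quotient.
  let P : Grassmannian n N r X → Prop := Quot.lift (fun x => x ∈ c.velDomain) (by
    rintro x y ⟨a, rfl⟩
    induction x using Quotient.inductionOn with | _ γ
    induction a using Quotient.inductionOn with | _ α
    exact propext (c.good_comp γ α).symm)
  have hP : P y.proj := hy
  rwa [hxy] at hP

/-- The first assertion: existence of the local Lagrangians. -/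
theorem HomogeneousLagrangian.exists_isLocal (ℒ : HomogeneousLagrangian n N r X)
    (c : AdaptedChart n N X) : ∃ L, ℒ.IsLocal c L := by
  obtain ⟨g, hg, hℒ⟩ := ℒ.smooth c.ψ
  -- The section of velocities written in the coordinates `x^A_J`; smooth, as the graphs depend
  -- smoothly on `u`.
  let s : c.Model r → Fin N → MultiIndex n r → ℝ := fun u A J => pdList J.list (c.graphMap u) 0 A
  have hs : ContDiff ℝ ∞ s := by
    refine contDiff_pi.2 fun A => contDiff_pi.2 fun J => contDiff_iff_contDiffAt.2 fun u => ?_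
    refine (EuclideanSpace.proj A : Eucl N →L[ℝ] ℝ).contDiff.contDiffAt.comp u ?_
    exact (contDiffAt_pdList_param J.list (f := fun u => c.graphMap u) (z := (u, 0))
      c.contDiff_graphMap.contDiffAt).comp u (contDiffAt_id.prodMk contDiffAt_const)
  have hcoord : ∀ (u : c.Model r) (hu : c.basePt r u ∈ c.ψ.1.target),
      velCoord c.ψ (c.section u hu) = s u := by
    intro u hu
    refine (if_pos (c.sectionGerm_mem u hu)).trans ?_
    funext A J
    exact congrArg (fun v : Eucl N => v A)
      (pdList_congr J.list (c.expr_sectionGerm u hu)).self_of_nhds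
  have hsec : ∀ (u : c.Model r) (hu : c.basePt r u ∈ c.ψ.1.target),
      c.section u hu ∈ (velDomain c.ψ : Set (Velocity n N r X)) := c.sectionGerm_mem
  refine ⟨fun p => g (s (c.coord p)), ⟨g ∘ s, hg.comp hs.contDiffOn ?_, fun _ _ => rfl⟩, ?_⟩
  · rw [c.coord_image_domain]
    exact fun u hu => ⟨_, hsec u hu, hcoord u hu⟩
  · intro x hx
    have hu := AdaptedChart.basePt_coord_mem (c := c) (p := x.proj) ⟨x, hx, rfl⟩
    -- Moving `x` to the section multiplies `ℒ` by `det(a) = det(𝐱)⁻¹`.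
    obtain ⟨a, ha, hdet⟩ := AdaptedChart.exists_act_eq_section hx hu
    have h := ℒ.homogeneous x a
    rw [ha, hdet, hℒ _ (hsec _ hu), hcoord] at h
    have hne : c.detX x ≠ 0 := by
      induction x using Quotient.inductionOn with | _ γ
      rw [AdaptedChart.detX_mk_of_good hx]
      exact hx.2
    change _ = c.detX x * g (s (c.coord x.proj))
    rw [h, mul_inv_cancel_left₀ hne]

end Section


/-! ### Changes of charts -/

section Transition

variable {n N r : ℕ} {X : Type*} [TopologicalSpace X] [ChartedSpace (Eucl N) X]

/-- The change of coordinates between two charts of `X`. -/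
def BaseChart.change (ψ ψ' : BaseChart N X) (v : Eucl N) : Eucl N := ψ'.1 (ψ.1.symm v)

theorem BaseChart.fderiv_change_self {ψ : BaseChart N X} {x : X} (hx : x ∈ ψ.1.source) :
    fderiv ℝ (ψ.change ψ) (ψ.1 x) = ContinuousLinearMap.id ℝ (Eucl N) := by
  have h : ψ.change ψ =ᶠ[𝓝 (ψ.1 x)] id := by
    filter_upwards [ψ.1.open_target.mem_nhds (ψ.1.map_source hx)] with v hv
    exact ψ.1.right_inv hv
  rw [h.fderiv_eq, fderiv_id]

variable [IsManifold (𝓡 N) ∞ X]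

theorem BaseChart.contDiffAt_change {ψ ψ' : BaseChart N X} {x : X} (hx : x ∈ ψ.1.source)
    (hx' : x ∈ ψ'.1.source) : ContDiffAt ℝ ∞ (ψ.change ψ') (ψ.1 x) :=
  (eventually_contDiffAt_transition ψ.2 ψ'.2 hx hx').self_of_nhds

theorem BaseChart.hasFDerivAt_change {ψ ψ' : BaseChart N X} {x : X} (hx : x ∈ ψ.1.source)
    (hx' : x ∈ ψ'.1.source) :
    HasFDerivAt (ψ.change ψ') (fderiv ℝ (ψ.change ψ') (ψ.1 x)) (ψ.1 x) :=
  ((BaseChart.contDiffAt_change hx hx').differentiableAt (by simp)).hasFDerivAt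

theorem BaseChart.fderiv_change_comp {ψ ψ' ψ'' : BaseChart N X} {x : X} (hx : x ∈ ψ.1.source)
    (hx' : x ∈ ψ'.1.source) (hx'' : x ∈ ψ''.1.source) :
    fderiv ℝ (ψ.change ψ'') (ψ.1 x) =
      (fderiv ℝ (ψ'.change ψ'') (ψ'.1 x)).comp (fderiv ℝ (ψ.change ψ') (ψ.1 x)) := by
  have e : ψ.change ψ' (ψ.1 x) = ψ'.1 x := by simp [BaseChart.change, ψ.1.left_inv hx]
  have h := BaseChart.hasFDerivAt_change hx' hx''
  rw [← e] at h
  rw [← e, ← (h.comp (ψ.1 x) (BaseChart.hasFDerivAt_change hx hx')).fderiv]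
  refine Filter.EventuallyEq.fderiv_eq ?_
  have hc : ContinuousAt ψ.1.symm (ψ.1 x) := ψ.1.continuousAt_symm (ψ.1.map_source hx)
  filter_upwards [hc.eventually (ψ'.1.open_source.mem_nhds (by rwa [ψ.1.left_inv hx]))] with v hv
  simp [BaseChart.change, ψ'.1.left_inv hv]

/-- The chain rule for the round trip `ψ → ψ' → ψ` provides a left inverse. -/
theorem BaseChart.fderiv_change_injective {ψ ψ' : BaseChart N X} {x : X} (hx : x ∈ ψ.1.source)
    (hx' : x ∈ ψ'.1.source) : Function.Injective (fderiv ℝ (ψ.change ψ') (ψ.1 x)) := by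
  have h := BaseChart.fderiv_change_comp hx hx' hx
  rw [BaseChart.fderiv_change_self hx] at h
  exact Function.LeftInverse.injective fun v => (DFunLike.congr_fun h v).symm

variable [NeZero r] {c c' : AdaptedChart n N X} {p : Grassmannian n N r X}

/-- The choice made in `transition` is harmless because the coordinates are injective on `ρ(W)`. -/
theorem AdaptedChart.transition_coord (hp : p ∈ c.domain) (hp' : p ∈ c'.domain) :
    c.transition r c' (c.coord p) = c'.coord p := by
  have h : ∃ q : Grassmannian n N r X, (q ∈ c.domain ∧ q ∈ c'.domain) ∧ c.coord q = c.coord p :=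
    ⟨p, ⟨hp, hp'⟩, rfl⟩
  refine (dif_pos h).trans ?_
  rw [c.coord_injOn h.choose_spec.1.1 hp h.choose_spec.2]

theorem AdaptedChart.good_sectionGerm_iff (u : c.Model r) (hu : c.basePt r u ∈ c.ψ.1.target) :
    c'.Good (c.sectionGerm u hu) ↔ (c.section u hu).proj ∈ c'.domain :=
  ⟨fun h => ⟨_, h, rfl⟩, fun h => AdaptedChart.mem_velDomain_of_proj_mem h⟩

/-- The base point of `p` in `X`. -/
noncomputable def AdaptedChart.baseOf (c : AdaptedChart n N X) (u : c.Model r) : X :=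
  c.ψ.1.symm (c.basePt r u)

theorem AdaptedChart.baseOf_mem (hp : p ∈ c.domain) : c.baseOf (c.coord p) ∈ c.ψ.1.source :=
  c.ψ.1.map_target (AdaptedChart.basePt_coord_mem hp)

theorem AdaptedChart.chart_baseOf (hp : p ∈ c.domain) :
    c.ψ.1 (c.baseOf (c.coord p)) = c.basePt r (c.coord p) :=
  c.ψ.1.right_inv (AdaptedChart.basePt_coord_mem hp)

theorem AdaptedChart.baseOf_eq (hp : p ∈ c.domain) (hp' : p ∈ c'.domain) :
    c.baseOf (c.coord p) = c'.baseOf (c'.coord p) := by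
  obtain ⟨x, hx, rfl⟩ := hp
  induction x using Quotient.inductionOn with | _ γ
  have hγ' : c'.Good γ := AdaptedChart.mem_velDomain_of_proj_mem hp'
  rw [AdaptedChart.baseOf, AdaptedChart.baseOf, AdaptedChart.basePt_coord hx,
    AdaptedChart.basePt_coord hγ']
  exact (c.ψ.1.left_inv hx.1).trans (c'.ψ.1.left_inv hγ'.1).symm

theorem AdaptedChart.baseOf_mem' (hp : p ∈ c.domain) (hp' : p ∈ c'.domain) :
    c.baseOf (c.coord p) ∈ c'.ψ.1.source := by
  rw [AdaptedChart.baseOf_eq hp hp']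
  exact AdaptedChart.baseOf_mem hp'

theorem AdaptedChart.contDiffAt_change_basePt (hp : p ∈ c.domain) (hp' : p ∈ c'.domain) :
    ContDiffAt ℝ ∞ (c.ψ.change c'.ψ) (c.basePt r (c.coord p)) := by
  rw [← AdaptedChart.chart_baseOf hp]
  exact BaseChart.contDiffAt_change (AdaptedChart.baseOf_mem hp) (AdaptedChart.baseOf_mem' hp hp')

theorem AdaptedChart.contDiffAt_change_graphMap (hp : p ∈ c.domain) (hp' : p ∈ c'.domain) :
    ContDiffAt ℝ ∞ (fun z : c.Model r × Eucl n => c.ψ.change c'.ψ (c.graphMap z.1 z.2))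
      (c.coord p, 0) := by
  refine ContDiffAt.comp (g := c.ψ.change c'.ψ) _ ?_ c.contDiff_graphMap.contDiffAt
  rw [c.graphMap_zero]
  exact AdaptedChart.contDiffAt_change_basePt hp hp'

theorem AdaptedChart.det_baseJac_change_ne (hp : p ∈ c.domain) (hp' : p ∈ c'.domain) :
    (baseJac c'.I (fun t => c.ψ.change c'.ψ (c.graphMap (c.coord p) t)) 0).det ≠ 0 := by
  have hu := AdaptedChart.basePt_coord_mem hp
  have h : c'.Good (c.sectionGerm (c.coord p) hu) := by
    rw [AdaptedChart.good_sectionGerm_iff, AdaptedChart.proj_section_coord hp]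
    exact hp'
  -- By definition the local expression in `c'` of the section germ is `ψ' ∘ ψ⁻¹` applied to the
  -- graph.
  exact h.2

/-- The graphs with coordinates near those of a point of the overlap lie in the overlap. -/
theorem AdaptedChart.eventually_section_mem (hp : p ∈ c.domain) (hp' : p ∈ c'.domain) :
    ∀ᶠ u in 𝓝 (c.coord p), ∃ hu : c.basePt r u ∈ c.ψ.1.target,
      (c.section u hu).proj ∈ c'.domain := by
  have h1 : ∀ᶠ u in 𝓝 (c.coord p), c.basePt r u ∈ c.ψ.1.target :=
    (c.basePt r).continuous.continuousAt.eventually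
      (c.ψ.1.open_target.mem_nhds (AdaptedChart.basePt_coord_mem hp))
  have h2 : ∀ᶠ u in 𝓝 (c.coord p), c.ψ.1.symm (c.basePt r u) ∈ c'.ψ.1.source :=
    ((c.ψ.1.continuousAt_symm (AdaptedChart.basePt_coord_mem hp)).comp
      (c.basePt r).continuous.continuousAt).eventually
      (c'.ψ.1.open_source.mem_nhds (AdaptedChart.baseOf_mem' hp hp'))
  have h3 : ContinuousAt (fun u : c.Model r =>
      (baseJac c'.I (fun t => c.ψ.change c'.ψ (c.graphMap u t)) 0).det) (c.coord p) :=
    ContinuousAt.comp (f := fun u : c.Model r => (u, (0 : Eucl n)))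
      (contDiffAt_det_baseJac_param c'.I (f := fun u t => c.ψ.change c'.ψ (c.graphMap u t))
        (AdaptedChart.contDiffAt_change_graphMap hp hp')).continuousAt
      (continuousAt_id.prodMk continuousAt_const)
  filter_upwards [h1, h2,
    h3.eventually (isOpen_ne.mem_nhds (AdaptedChart.det_baseJac_change_ne hp hp'))] with u hu hu' hd
  refine ⟨hu, (AdaptedChart.good_sectionGerm_iff u hu).1 ⟨?_, hd⟩⟩
  rwa [c.sectionGerm_zero]

/-- Replaces the choice in `transition` by an explicit formula. Since
`AdaptedChart.eventually_section_mem` makes it available on a neighbourhood, the change of charts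
can be differentiated. -/
theorem AdaptedChart.transition_of_section_mem {u : c.Model r} (hu : c.basePt r u ∈ c.ψ.1.target)
    (h : (c.section u hu).proj ∈ c'.domain) :
    c.transition r c' u =
      ((fun i => c.ψ.change c'.ψ (c.graphMap u 0) (c'.I i), fun σ (J : MultiIndex n r) =>
        graphDeriv c'.I (fun t => c.ψ.change c'.ψ (c.graphMap u t)) σ J.list 0) : c'.Model r) := by
  have e := AdaptedChart.transition_coord (c.proj_section_mem_domain u hu) h
  rw [c.coord_section u hu] at e
  rw [e]
  exact AdaptedChart.coord_mk_of_good ((AdaptedChart.good_sectionGerm_iff u hu).2 h)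

theorem AdaptedChart.contDiffAt_transition (hp : p ∈ c.domain) (hp' : p ∈ c'.domain) :
    ContDiffAt ℝ ∞ (c.transition r c') (c.coord p) := by
  have hz : ContDiffAt ℝ ∞ (fun u : c.Model r => (u, (0 : Eucl n))) (c.coord p) :=
    contDiffAt_id.prodMk contDiffAt_const
  have h : ContDiffAt ℝ ∞ (fun u : c.Model r =>
      ((fun i => c.ψ.change c'.ψ (c.graphMap u 0) (c'.I i), fun σ (J : MultiIndex n r) =>
        graphDeriv c'.I (fun t => c.ψ.change c'.ψ (c.graphMap u t)) σ J.list 0) : c'.Model r))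
      (c.coord p) := by
    refine ContDiffAt.prodMk (contDiffAt_pi.2 fun i => ?_)
      (contDiffAt_pi.2 fun σ => contDiffAt_pi.2 fun J => ?_)
    · exact (EuclideanSpace.proj (c'.I i) : Eucl N →L[ℝ] ℝ).contDiff.contDiffAt.comp (c.coord p)
        (ContDiffAt.comp (f := fun u : c.Model r => (u, (0 : Eucl n)))
          (g := fun z : c.Model r × Eucl n => c.ψ.change c'.ψ (c.graphMap z.1 z.2)) (c.coord p)
          (AdaptedChart.contDiffAt_change_graphMap hp hp') hz)
    · exact (contDiffAt_graphDeriv_param c'.I (f := fun u t => c.ψ.change c'.ψ (c.graphMap u t))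
        (AdaptedChart.contDiffAt_change_graphMap hp hp')
        (AdaptedChart.det_baseJac_change_ne hp hp') σ J.list).comp (c.coord p) hz
  refine h.congr_of_eventuallyEq ?_
  filter_upwards [AdaptedChart.eventually_section_mem hp hp'] with u ⟨hu, hu'⟩
  exact AdaptedChart.transition_of_section_mem hu hu'

theorem AdaptedChart.basePt_transition (hp : p ∈ c.domain) (hp' : p ∈ c'.domain) :
    (fun u => c'.basePt r (c.transition r c' u)) =ᶠ[𝓝 (c.coord p)]
      fun u => c.ψ.change c'.ψ (c.basePt r u) := by
  filter_upwards [AdaptedChart.eventually_section_mem hp hp'] with u ⟨hu, hu'⟩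
  have e := AdaptedChart.transition_coord (c.proj_section_mem_domain u hu) hu'
  rw [c.coord_section u hu] at e
  rw [e, ← c.graphMap_zero u]
  exact AdaptedChart.basePt_coord ((AdaptedChart.good_sectionGerm_iff u hu).2 hu')

/-- The change of charts covers the change of coordinates of `X`. Everything below uses only this
projection of its differential, never the higher components. -/
theorem AdaptedChart.basePt_fderiv_transition (hp : p ∈ c.domain) (hp' : p ∈ c'.domain)
    (v : c.Model r) :
    c'.basePt r (fderiv ℝ (c.transition r c') (c.coord p) v) =
      fderiv ℝ (c.ψ.change c'.ψ) (c.basePt r (c.coord p)) (c.basePt r v) := by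
  have h1 := (c'.basePt r).hasFDerivAt.comp (c.coord p)
    ((AdaptedChart.contDiffAt_transition hp hp').differentiableAt (by simp)).hasFDerivAt
  have h2 := (((AdaptedChart.contDiffAt_change_basePt hp hp').differentiableAt
    (by simp)).hasFDerivAt).comp (c.coord p) (c.basePt r).hasFDerivAt
  exact DFunLike.congr_fun
    (h1.unique (h2.congr_of_eventuallyEq (AdaptedChart.basePt_transition hp hp'))) v

/-- The matrix `(D_i x̄^j)`. -/
noncomputable def AdaptedChart.jacobianMatrix (c c' : AdaptedChart n N X)
    (p : Grassmannian n N r X) : Matrix (Fin n) (Fin n) ℝ :=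
  Matrix.of fun i j : Fin n => c.totalDeriv i (fun u => (c.transition r c' u).1 j) (c.coord p)

theorem AdaptedChart.jacobianMatrix_apply (hp : p ∈ c.domain) (hp' : p ∈ c'.domain)
    (i j : Fin n) : c.jacobianMatrix c' p i j =
      fderiv ℝ (c.ψ.change c'.ψ) (c.basePt r (c.coord p))
        (c.basePt r (c.totalVec i (c.coord p))) (c'.I j) := by
  rw [← AdaptedChart.basePt_fderiv_transition hp hp', c'.basePt_base]
  have h := ((ContinuousLinearMap.proj (R := ℝ) (φ := fun _ : Fin n => ℝ) j).comp
    (ContinuousLinearMap.fst ℝ (Fin n → ℝ)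
      ({σ : Fin N // σ ∉ Set.range c'.I} → MultiIndex n r → ℝ))).hasFDerivAt.comp (c.coord p)
    ((AdaptedChart.contDiffAt_transition hp hp').differentiableAt (by simp)).hasFDerivAt
  exact DFunLike.congr_fun h.fderiv _

/-- For a graph `𝐱 = 1`, so its partial derivatives at `0` are exactly the vectors `E_i`; the rest
is the chain rule. -/
theorem AdaptedChart.pd_change_graphMap (hp : p ∈ c.domain) (hp' : p ∈ c'.domain) (i : Fin n) :
    pd i (fun t => c.ψ.change c'.ψ (c.graphMap (c.coord p) t)) 0 =
      fderiv ℝ (c.ψ.change c'.ψ) (c.basePt r (c.coord p))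
        (c.basePt r (c.totalVec i (c.coord p))) := by
  set u := c.coord p
  have hE : pd i (c.graphMap u) 0 = c.basePt r (c.totalVec i u) := by
    rw [c.pd_eq_sum_totalVec u (c.contDiff_graphMap_right u).contDiffAt
      (by rw [c.baseJac_graphMap]; simp) (fun σ J => (c.graphDeriv_graphMap u σ J).symm) i,
      c.baseJac_graphMap]
    simp [Matrix.one_apply]
  have h1 : HasFDerivAt (c.ψ.change c'.ψ) (fderiv ℝ (c.ψ.change c'.ψ) (c.basePt r u))
      (c.graphMap u 0) := by
    rw [c.graphMap_zero]
    exact ((AdaptedChart.contDiffAt_change_basePt hp hp').differentiableAt (by simp)).hasFDerivAt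
  rw [← hE]
  exact DFunLike.congr_fun (h1.comp (0 : Eucl n)
    ((c.contDiff_graphMap_right u).differentiable (by simp) 0).hasFDerivAt).fderiv _

/-- The transpose is a matter of conventions: rows of `baseJac` are components, rows of `(D_i x̄^j)`
are directions of differentiation. -/
theorem AdaptedChart.baseJac_change_graphMap (hp : p ∈ c.domain) (hp' : p ∈ c'.domain) :
    baseJac c'.I (fun t => c.ψ.change c'.ψ (c.graphMap (c.coord p) t)) 0 =
      (c.jacobianMatrix c' p).transpose := by
  ext j i
  rw [Matrix.transpose_apply, AdaptedChart.jacobianMatrix_apply hp hp',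
    ← AdaptedChart.pd_change_graphMap hp hp']
  rfl

/-- `D_i = (D_i x̄^j) D̄_j`, projected to `X`. -/
theorem AdaptedChart.change_totalVec (hp : p ∈ c.domain) (hp' : p ∈ c'.domain) (i : Fin n) :
    fderiv ℝ (c.ψ.change c'.ψ) (c.basePt r (c.coord p)) (c.basePt r (c.totalVec i (c.coord p))) =
      ∑ j, c.jacobianMatrix c' p i j • c'.basePt r (c'.totalVec j (c'.coord p)) := by
  have hu := AdaptedChart.basePt_coord_mem hp
  have hs := AdaptedChart.proj_section_coord hp hu
  have hc := AdaptedChart.transition_of_section_mem (c := c) (c' := c') hu (by rwa [hs])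
  rw [AdaptedChart.transition_coord hp hp'] at hc
  have hF : ContDiffAt ℝ ∞ (fun t => c.ψ.change c'.ψ (c.graphMap (c.coord p) t)) 0 :=
    (AdaptedChart.contDiffAt_change_graphMap hp hp').comp (0 : Eucl n)
      (contDiffAt_const.prodMk contDiffAt_id)
  -- The derivative of the graph, seen in the second chart, is expanded in the vectors `Ē_j` of that
  -- chart.
  rw [← AdaptedChart.pd_change_graphMap hp hp',
    c'.pd_eq_sum_totalVec (c'.coord p) hF (AdaptedChart.det_baseJac_change_ne hp hp')
      (fun σ J => by rw [hc]) i, AdaptedChart.baseJac_change_graphMap hp hp']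
  rfl

/-- The second assertion: the transformation law of the local Lagrangians. -/
theorem HomogeneousLagrangian.local_eq_jacobian_mul (ℒ : HomogeneousLagrangian n N r X)
    {L L' : Grassmannian n N r X → ℝ} (hL : ℒ.IsLocal c L) (hL' : ℒ.IsLocal c' L')
    (hp : p ∈ c.domain) (hp' : p ∈ c'.domain) : L p = c.jacobian c' p * L' p := by
  have hu := AdaptedChart.basePt_coord_mem hp
  have hs := AdaptedChart.proj_section_coord hp hu
  have hx := c.good_sectionGerm (c.coord p) hu
  have hx' : c'.Good (c.sectionGerm (c.coord p) hu) := by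
    rw [AdaptedChart.good_sectionGerm_iff, hs]
    exact hp'
  have h1 := hL.2 (c.section (c.coord p) hu) hx
  have h2 := hL'.2 (c.section (c.coord p) hu) hx'
  -- Both defining relations are compared on the graph of the first chart, where one determinant is
  -- `1` and the other is `𝒥`.
  have d1 : c.detX (c.section (c.coord p) hu) = 1 := by
    refine (AdaptedChart.detX_mk_of_good hx).trans ?_
    rw [(baseJac_congr c.I (c.expr_sectionGerm _ hu)).self_of_nhds, c.baseJac_graphMap,
      Matrix.det_one]
  have d2 : c'.detX (c.section (c.coord p) hu) = c.jacobian c' p := by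
    refine (AdaptedChart.detX_mk_of_good hx').trans ?_
    refine (congrArg Matrix.det (AdaptedChart.baseJac_change_graphMap hp hp')).trans ?_
    rw [Matrix.det_transpose]
    rfl
  rw [hs, d1, one_mul] at h1
  rw [hs, d2] at h2
  rw [← h1, h2]

end Transition

/-! ### A Riemannian metric on `X`, in charts -/

section Metric

variable {N : ℕ} {X : Type*} [TopologicalSpace X] [ChartedSpace (Eucl N) X]
  [IsManifold (𝓡 N) ∞ X]

/-- The preferred chart at `a`. -/
def BaseChart.at (N : ℕ) {X : Type*} [TopologicalSpace X] [ChartedSpace (Eucl N) X]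
    [IsManifold (𝓡 N) ∞ X] (a : X) : BaseChart N X :=
  ⟨chartAt (Eucl N) a, IsManifold.chart_mem_maximalAtlas a⟩

/-- The value `g(v, w)` at `x`, in the chart `ψ`, of the Riemannian metric obtained from the
Euclidean metrics of the preferred charts by means of a partition of unity. -/
noncomputable def metricAt (f : SmoothPartitionOfUnity X (𝓡 N) X Set.univ) (ψ : BaseChart N X)
    (x : X) : Eucl N →ₗ[ℝ] Eucl N →ₗ[ℝ] ℝ :=
  ∑ a ∈ f.finsupport x, f a x • (innerₗ (Eucl N)).compl₁₂
    (fderiv ℝ (ψ.change (BaseChart.at N a)) (ψ.1 x) : Eucl N →ₗ[ℝ] Eucl N)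
    (fderiv ℝ (ψ.change (BaseChart.at N a)) (ψ.1 x) : Eucl N →ₗ[ℝ] Eucl N)

variable {f : SmoothPartitionOfUnity X (𝓡 N) X Set.univ} {ψ ψ' : BaseChart N X} {x : X}

theorem metricAt_apply (v w : Eucl N) :
    metricAt f ψ x v w = ∑ a ∈ f.finsupport x, f a x *
      inner ℝ (fderiv ℝ (ψ.change (BaseChart.at N a)) (ψ.1 x) v)
        (fderiv ℝ (ψ.change (BaseChart.at N a)) (ψ.1 x) w) := by
  simp [metricAt, LinearMap.sum_apply]

/-- The change to the chart at `a` is smooth only over its domain; subordination guarantees this for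
every `a` whose bump function has `x` in its closed support. -/
theorem contMDiffAt_metricAt (hf : f.IsSubordinate fun a => (chartAt (Eucl N) a).source)
    (hx : x ∈ ψ.1.source) (v w : Eucl N) :
    ContMDiffAt (𝓡 N) 𝓘(ℝ, ℝ) ∞ (fun x => metricAt f ψ x v w) x := by
  -- The index set `f.finsupport x` varies with `x`; as a locally finite sum over all `a` the
  -- expression can be differentiated.
  have e : (fun x => metricAt f ψ x v w) = fun x => ∑ᶠ a, f a x •
      (inner ℝ (fderiv ℝ (ψ.change (BaseChart.at N a)) (ψ.1 x) v)
        (fderiv ℝ (ψ.change (BaseChart.at N a)) (ψ.1 x) w) : ℝ) := by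
    funext x
    rw [metricAt_apply]
    exact f.sum_finsupport_smul_eq_finsum x fun a x =>
      (inner ℝ (fderiv ℝ (ψ.change (BaseChart.at N a)) (ψ.1 x) v)
        (fderiv ℝ (ψ.change (BaseChart.at N a)) (ψ.1 x) w) : ℝ)
  rw [e]
  refine f.contMDiffAt_finsum fun a ha => ?_
  have hs : x ∈ (BaseChart.at N a).1.source := hf a ha
  have hd : ContDiffAt ℝ ∞ (fderiv ℝ (ψ.change (BaseChart.at N a))) (ψ.1 x) :=
    (BaseChart.contDiffAt_change hx hs).fderiv_right (m := ∞) (by simp)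
  have hi : ContDiffAt ℝ ∞ (fun y => (inner ℝ (fderiv ℝ (ψ.change (BaseChart.at N a)) y v)
      (fderiv ℝ (ψ.change (BaseChart.at N a)) y w) : ℝ)) (ψ.1 x) :=
    (hd.clm_apply contDiffAt_const).inner ℝ (hd.clm_apply contDiffAt_const)
  exact hi.contMDiffAt.comp x (contMDiffAt_of_mem_maximalAtlas ψ.2 hx)

theorem mem_source_of_mem_finsupport (hf : f.IsSubordinate fun a => (chartAt (Eucl N) a).source)
    {a : X} (ha : a ∈ f.finsupport x) : x ∈ (BaseChart.at N a).1.source :=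
  hf a (subset_tsupport _ ((f.mem_finsupport x).1 ha))

theorem metricAt_change (hf : f.IsSubordinate fun a => (chartAt (Eucl N) a).source)
    (hx : x ∈ ψ.1.source) (hx' : x ∈ ψ'.1.source) (v w : Eucl N) :
    metricAt f ψ x v w = metricAt f ψ' x (fderiv ℝ (ψ.change ψ') (ψ.1 x) v)
      (fderiv ℝ (ψ.change ψ') (ψ.1 x) w) := by
  rw [metricAt_apply, metricAt_apply]
  refine Finset.sum_congr rfl fun a ha => ?_
  rw [BaseChart.fderiv_change_comp hx hx' (mem_source_of_mem_finsupport hf ha)]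
  rfl

/-- All terms are non-negative and at least one weight is positive, so `v` has zero image in some
preferred chart; changes of charts have injective differential. -/
theorem eq_zero_of_metricAt_self (hf : f.IsSubordinate fun a => (chartAt (Eucl N) a).source)
    (hx : x ∈ ψ.1.source) {v : Eucl N} (h : metricAt f ψ x v v = 0) : v = 0 := by
  rw [metricAt_apply, Finset.sum_eq_zero_iff_of_nonneg
    fun a _ => mul_nonneg (f.nonneg a x) real_inner_self_nonneg] at h
  obtain ⟨a, ha⟩ := f.exists_pos_of_mem (Set.mem_univ x)
  have ha' : a ∈ f.finsupport x := (f.mem_finsupport x).2 ha.ne'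
  have h0 := (mul_eq_zero.1 (h a ha')).resolve_left ha.ne'
  rw [inner_self_eq_zero] at h0
  exact BaseChart.fderiv_change_injective hx (mem_source_of_mem_finsupport hf ha')
    (h0.trans (map_zero _).symm)

/-- The Gram matrix of linearly independent vectors is invertible. -/
theorem det_gram_ne_zero (hf : f.IsSubordinate fun a => (chartAt (Eucl N) a).source)
    (hx : x ∈ ψ.1.source) {n : ℕ} {E : Fin n → Eucl N} (hE : LinearIndependent ℝ E) :
    (Matrix.of fun i j => metricAt f ψ x (E i) (E j)).det ≠ 0 := by
  intro h
  -- A kernel vector `m` makes `∑ m_j E_j` orthogonal to every `E_i`, hence to itself.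
  obtain ⟨m, hm, h0⟩ := Matrix.exists_mulVec_eq_zero_iff.2 h
  have h1 : ∀ i, metricAt f ψ x (E i) (∑ j, m j • E j) = 0 := fun i => by
    have := congrFun h0 i
    simpa [Matrix.mulVec, dotProduct, mul_comm] using this
  have h2 : metricAt f ψ x (∑ j, m j • E j) (∑ j, m j • E j) = 0 := by
    have e : metricAt f ψ x (∑ i, m i • E i) = ∑ i, m i • metricAt f ψ x (E i) := by simp
    rw [e, LinearMap.sum_apply]
    exact Finset.sum_eq_zero fun i _ => by rw [LinearMap.smul_apply, h1, smul_zero]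
  exact hm (funext (Fintype.linearIndependent_iff.1 hE m (eq_zero_of_metricAt_self hf hx h2)))

end Metric

/-! ### Wedge products of covectors -/

section Wedge

/-- The determinant as an alternating form on `ℝⁿ`. -/
noncomputable def detForm (n : ℕ) : (Fin n → ℝ) [⋀^Fin n]→L[ℝ] ℝ :=
  { Matrix.detRowAlternating (R := ℝ) (n := Fin n) with
    cont := by
      change Continuous fun v : Fin n → Fin n → ℝ => Matrix.det (Matrix.of v)
      exact Continuous.matrix_det continuous_id }

variable {n N : ℕ} {M : Type} [NormedAddCommGroup M] [NormedSpace ℝ M]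

/-- The wedge product of the covectors `∑_A a_{iA} ℓ_A`, `i = 1, …, n`. -/
noncomputable def wedgeForm (ℓ : Fin N → M →L[ℝ] ℝ) (a : Fin n → Fin N → ℝ) :
    M [⋀^Fin n]→L[ℝ] ℝ :=
  ∑ κ : Fin n → Fin N, (∏ i, a i (κ i)) •
    (detForm n).compContinuousLinearMap (ContinuousLinearMap.pi fun i => ℓ (κ i))

/-- Multilinear expansion of the determinant in its rows. The expanded form has polynomial
coefficients in `a` and fixed forms, from which smooth dependence on `a` can be read off. -/
theorem wedgeForm_apply (ℓ : Fin N → M →L[ℝ] ℝ) (a : Fin n → Fin N → ℝ) (v : Fin n → M) :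
    wedgeForm ℓ a v = (Matrix.of fun i j => ∑ A, a i A * ℓ A (v j)).det := by
  have e : (Matrix.of fun i j => ∑ A, a i A * ℓ A (v j)) =
      (fun i => ∑ A, a i A • (fun j => ℓ A (v j)) : Fin n → Fin n → ℝ) := by
    funext i j
    simp
  have h := (Matrix.detRowAlternating (R := ℝ) (n := Fin n)).toMultilinearMap.map_sum
    (fun (i : Fin n) (A : Fin N) => a i A • (fun j => ℓ A (v j)))
  rw [e]
  refine Eq.trans ?_ h.symm
  simp only [wedgeForm, ContinuousAlternatingMap.sum_apply, ContinuousAlternatingMap.smul_apply,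
    MultilinearMap.map_smul_univ]
  refine Finset.sum_congr rfl fun κ _ => ?_
  congr 1
  exact Matrix.det_transpose (Matrix.of fun i j => ℓ (κ i) (v j))

end Wedge

/-! ### The form on the Grassmannian bundle defined by a metric -/

section MetricForm

variable {n N r : ℕ} {X : Type*} [TopologicalSpace X] [ChartedSpace (Eucl N) X]

theorem AdaptedChart.contDiff_totalVec (c : AdaptedChart n N X) (i : Fin n) :
    ContDiff ℝ ∞ fun u : c.Model r => c.totalVec i u := by
  refine contDiff_const.prodMk (contDiff_pi.2 fun σ => contDiff_pi.2 fun J => ?_)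
  split_ifs with h
  · exact ((ContinuousLinearMap.proj (R := ℝ) (φ := fun _ : MultiIndex n r => ℝ) _).comp
      ((ContinuousLinearMap.proj (R := ℝ)
        (φ := fun _ : {σ : Fin N // σ ∉ Set.range c.I} => MultiIndex n r → ℝ) σ).comp
        (ContinuousLinearMap.snd ℝ (Fin n → ℝ) _))).contDiff
  · exact contDiff_const

theorem AdaptedChart.linearIndependent_totalVec (c : AdaptedChart n N X) (u : c.Model r) :
    LinearIndependent ℝ fun i => c.basePt r (c.totalVec i u) := by
  refine Fintype.linearIndependent_iff.2 fun m hm k => ?_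
  have := congrArg (fun v : Eucl N => v (c.I k)) hm
  simpa [c.basePt_totalVec_base] using this

variable [IsManifold (𝓡 N) ∞ X] (f : SmoothPartitionOfUnity X (𝓡 N) X Set.univ)

/-- The Gram matrix of the vectors `E_i`, the projections to `X` of the total derivatives `D_i`. -/
noncomputable def AdaptedChart.gram (c : AdaptedChart n N X) (u : c.Model r) :
    Matrix (Fin n) (Fin n) ℝ :=
  Matrix.of fun i j => metricAt f c.ψ (c.baseOf u) (c.basePt r (c.totalVec i u))
    (c.basePt r (c.totalVec j u))

/-- The horizontal `n`-form whose value on `n` vectors is the determinant of the coefficients, with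
respect to the vectors `E_i`, of the orthogonal projections to the contact element. -/
noncomputable def AdaptedChart.metricForm (c : AdaptedChart n N X) (u : c.Model r) :
    c.Model r [⋀^Fin n]→L[ℝ] ℝ :=
  (c.gram f u).det⁻¹ • wedgeForm (fun A => (EuclideanSpace.proj A).comp (c.basePt r))
    fun i A => metricAt f c.ψ (c.baseOf u) (c.basePt r (c.totalVec i u))
      (EuclideanSpace.single A 1)

variable {f}

theorem AdaptedChart.metricForm_apply (c : AdaptedChart n N X) (u : c.Model r)
    (v : Fin n → c.Model r) : c.metricForm f u v = (c.gram f u).det⁻¹ *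
      (Matrix.of fun i j => metricAt f c.ψ (c.baseOf u) (c.basePt r (c.totalVec i u))
        (c.basePt r (v j))).det := by
  simp only [AdaptedChart.metricForm, ContinuousAlternatingMap.smul_apply, wedgeForm_apply,
    smul_eq_mul]
  congr 3
  ext i j
  conv_rhs => rw [← (EuclideanSpace.basisFun (Fin N) ℝ).sum_repr (c.basePt r (v j))]
  simp [mul_comm]

theorem AdaptedChart.contDiffAt_metricAt
    (hf : f.IsSubordinate fun a => (chartAt (Eucl N) a).source) (c : AdaptedChart n N X)
    {u : c.Model r} (hu : c.basePt r u ∈ c.ψ.1.target) {v w : c.Model r → Eucl N}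
    (hv : ContDiffAt ℝ ∞ v u) (hw : ContDiffAt ℝ ∞ w u) :
    ContDiffAt ℝ ∞ (fun u => metricAt f c.ψ (c.baseOf u) (v u) (w u)) u := by
  -- Smoothness of the metric is known for fixed vectors, so the varying ones are expanded in the
  -- standard basis.
  have e : (fun u => metricAt f c.ψ (c.baseOf u) (v u) (w u)) = fun u => ∑ A, ∑ B,
      v u A * (w u B * metricAt f c.ψ (c.baseOf u) (EuclideanSpace.single A 1)
        (EuclideanSpace.single B 1)) := by
    funext u
    conv_lhs => rw [← (EuclideanSpace.basisFun (Fin N) ℝ).sum_repr (v u),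
      ← (EuclideanSpace.basisFun (Fin N) ℝ).sum_repr (w u)]
    simp only [EuclideanSpace.basisFun_repr, EuclideanSpace.basisFun_apply, map_sum, map_smul,
      LinearMap.sum_apply, LinearMap.smul_apply, Finset.mul_sum, smul_eq_mul]
    rw [Finset.sum_comm]
    exact Finset.sum_congr rfl fun A _ => Finset.sum_congr rfl fun B _ => by ring
  rw [e]
  have hb : ContMDiffAt 𝓘(ℝ, c.Model r) (𝓡 N) ∞ (fun u : c.Model r => c.baseOf u) u :=
    (contMDiffAt_symm_of_mem_maximalAtlas c.ψ.2 hu).comp u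
      (c.basePt r).contDiff.contDiffAt.contMDiffAt
  have hm : ∀ A B, ContDiffAt ℝ ∞ (fun u : c.Model r => metricAt f c.ψ (c.baseOf u)
      (EuclideanSpace.single A 1) (EuclideanSpace.single B 1)) u := fun A B =>
    (ContMDiffAt.comp (f := fun u : c.Model r => c.baseOf u) (g := fun x => metricAt f c.ψ x
      (EuclideanSpace.single A 1) (EuclideanSpace.single B 1)) u
      (contMDiffAt_metricAt hf (c.ψ.1.map_target hu) _ _) hb).contDiffAt
  exact ContDiffAt.sum fun A _ => ContDiffAt.sum fun B _ =>
    ((EuclideanSpace.proj A : Eucl N →L[ℝ] ℝ).contDiff.contDiffAt.comp u hv).mul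
      (((EuclideanSpace.proj B : Eucl N →L[ℝ] ℝ).contDiff.contDiffAt.comp u hw).mul (hm A B))

theorem AdaptedChart.det_gram_ne (hf : f.IsSubordinate fun a => (chartAt (Eucl N) a).source)
    (c : AdaptedChart n N X) {u : c.Model r} (hu : c.basePt r u ∈ c.ψ.1.target) :
    (c.gram f u).det ≠ 0 :=
  det_gram_ne_zero hf (c.ψ.1.map_target hu) (c.linearIndependent_totalVec u)

theorem AdaptedChart.contDiffAt_metricForm
    (hf : f.IsSubordinate fun a => (chartAt (Eucl N) a).source) (c : AdaptedChart n N X)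
    {u : c.Model r} (hu : c.basePt r u ∈ c.ψ.1.target) :
    ContDiffAt ℝ ∞ (fun u : c.Model r => c.metricForm f u) u := by
  have hE : ∀ i, ContDiffAt ℝ ∞ (fun u : c.Model r => c.basePt r (c.totalVec i u)) u := fun i =>
    ((c.basePt r).contDiff.comp (c.contDiff_totalVec i)).contDiffAt
  have hG : ContDiffAt ℝ ∞ (fun u : c.Model r => (c.gram f u).det) u := by
    simp only [Matrix.det_apply]
    exact ContDiffAt.sum fun τ _ => (contDiffAt_prod fun i _ =>
      c.contDiffAt_metricAt hf hu (hE _) (hE _)).const_smul _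
  have ha : ∀ i A, ContDiffAt ℝ ∞ (fun u : c.Model r => metricAt f c.ψ (c.baseOf u)
      (c.basePt r (c.totalVec i u)) (EuclideanSpace.single A 1)) u := fun i A =>
    c.contDiffAt_metricAt hf hu (hE i) contDiffAt_const
  exact (hG.inv (c.det_gram_ne hf hu)).smul (ContDiffAt.sum fun κ _ =>
    (contDiffAt_prod fun i _ => ha i (κ i)).smul contDiffAt_const)

/-- On vectors tangent to the contact elements the form is `dx¹ ∧ ⋯ ∧ dxⁿ`. -/
theorem AdaptedChart.metricForm_apply_of_horizontal
    (hf : f.IsSubordinate fun a => (chartAt (Eucl N) a).source) (c : AdaptedChart n N X)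
    {u : c.Model r} (hu : c.basePt r u ∈ c.ψ.1.target) {v : Fin n → c.Model r}
    (hv : ∀ j, c.basePt r (v j) = ∑ k, (v j).1 k • c.basePt r (c.totalVec k u)) :
    c.metricForm f u v = c.theta r v := by
  -- Horizontality writes the second matrix as the Gram matrix times `(dx^k(v_j))`; the Gram
  -- determinant then cancels.
  have e : (Matrix.of fun i j => metricAt f c.ψ (c.baseOf u) (c.basePt r (c.totalVec i u))
      (c.basePt r (v j))) = c.gram f u * (Matrix.of fun i j => (v i).1 j).transpose := by
    ext i j
    simp [hv j, Matrix.mul_apply, AdaptedChart.gram, mul_comm]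
  rw [c.metricForm_apply, e, Matrix.det_mul, Matrix.det_transpose,
    inv_mul_cancel_left₀ (c.det_gram_ne hf hu)]
  rfl

variable [NeZero r]

/-- With `M = (D_i x̄^j)` and `E_i = M_{ij} Ē_j`, the mixed determinant picks up `det M` and the
Gram determinant `(det M)²`, so one factor `det M = 𝒥` is missing. -/
theorem AdaptedChart.metricForm_transition
    (hf : f.IsSubordinate fun a => (chartAt (Eucl N) a).source) {c c' : AdaptedChart n N X}
    {p : Grassmannian n N r X} (hp : p ∈ c.domain) (hp' : p ∈ c'.domain) :
    c.jacobian c' p • c.metricForm f (c.coord p) =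
      (c'.metricForm f (c'.coord p)).compContinuousLinearMap
        (fderiv ℝ (c.transition r c') (c.coord p)) := by
  set M := c.jacobianMatrix c' p with hM
  have hJ : c.jacobian c' p = M.det := rfl
  have key : ∀ (i : Fin n) (w : c.Model r),
      metricAt f c.ψ (c.baseOf (c.coord p)) (c.basePt r (c.totalVec i (c.coord p)))
        (c.basePt r w) = ∑ j, M i j * metricAt f c'.ψ (c'.baseOf (c'.coord p))
          (c'.basePt r (c'.totalVec j (c'.coord p)))
          (c'.basePt r (fderiv ℝ (c.transition r c') (c.coord p) w)) := by
    intro i w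
    rw [metricAt_change hf (AdaptedChart.baseOf_mem hp) (AdaptedChart.baseOf_mem' hp hp'),
      AdaptedChart.chart_baseOf hp, AdaptedChart.change_totalVec hp hp',
      ← AdaptedChart.basePt_fderiv_transition hp hp', AdaptedChart.baseOf_eq hp hp']
    simp [LinearMap.sum_apply, ← hM]
  have hv : ∀ v : Fin n → c.Model r,
      (Matrix.of fun i j => metricAt f c.ψ (c.baseOf (c.coord p))
        (c.basePt r (c.totalVec i (c.coord p))) (c.basePt r (v j))) =
      M * Matrix.of fun i j => metricAt f c'.ψ (c'.baseOf (c'.coord p))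
        (c'.basePt r (c'.totalVec i (c'.coord p)))
        (c'.basePt r (fderiv ℝ (c.transition r c') (c.coord p) (v j))) := by
    intro v
    ext i j
    simp [Matrix.mul_apply, key]
  have hG : c.gram f (c.coord p) = M * c'.gram f (c'.coord p) * M.transpose := by
    ext i j
    rw [AdaptedChart.gram, Matrix.of_apply, key,
      AdaptedChart.basePt_fderiv_transition hp hp', AdaptedChart.change_totalVec hp hp', ← hM,
      Matrix.mul_assoc, Matrix.mul_apply]
    refine Finset.sum_congr rfl fun k _ => ?_
    congr 1
    simp [Matrix.mul_apply, AdaptedChart.gram, mul_comm]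
  have hne : (c.gram f (c.coord p)).det ≠ 0 :=
    c.det_gram_ne hf (AdaptedChart.basePt_coord_mem hp)
  -- Non-vanishing of `𝒥` comes for free: it is a factor of a non-zero Gram determinant.
  rw [hG, Matrix.det_mul, Matrix.det_mul, Matrix.det_transpose] at hne
  obtain ⟨h1, h2⟩ := mul_ne_zero_iff.1 hne
  obtain ⟨-, h3⟩ := mul_ne_zero_iff.1 h1
  ext v
  rw [ContinuousAlternatingMap.smul_apply, ContinuousAlternatingMap.compContinuousLinearMap_apply,
    c.metricForm_apply, c'.metricForm_apply, hv, hG, hJ, Matrix.det_mul, Matrix.det_mul,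
    Matrix.det_mul, Matrix.det_transpose]
  simp only [Function.comp_apply, smul_eq_mul]
  field_simp

end MetricForm

/-! ### Prolongations of immersions -/

section Prolongation

variable {n N r : ℕ} {X : Type*} [TopologicalSpace X] [ChartedSpace (Eucl N) X]
  {c : AdaptedChart n N X} {γ : Immersion n N X} {t : Eucl n}

/-- The local expression of an immersion. -/
def AdaptedChart.immExpr (c : AdaptedChart n N X) (γ : Immersion n N X) (t : Eucl n) : Eucl N :=
  c.ψ.1 (γ.toFun t)

theorem AdaptedChart.expr_germAt (s : Eucl n) :
    c.expr (γ.germAt s) = fun τ => c.immExpr γ (s + τ) := rfl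

theorem AdaptedChart.good_germAt_iff (s : Eucl n) : c.Good (γ.germAt s) ↔
    γ.toFun s ∈ c.ψ.1.source ∧ (baseJac c.I (c.immExpr γ) s).det ≠ 0 := by
  rw [AdaptedChart.Good, AdaptedChart.expr_germAt, baseJac_translate, add_zero]
  simp [Immersion.germAt]

theorem AdaptedChart.contDiffAt_immExpr (h : γ.toFun t ∈ c.ψ.1.source) :
    ContDiffAt ℝ ∞ (c.immExpr γ) t :=
  ((contMDiffAt_of_mem_maximalAtlas c.ψ.2 h).comp t (γ.smooth t)).contDiffAt

theorem AdaptedChart.eventually_good_germAt (h : c.Good (γ.germAt t)) :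
    ∀ᶠ s in 𝓝 t, c.Good (γ.germAt s) := by
  rw [AdaptedChart.good_germAt_iff] at h
  -- The statement with parameters is used with a dummy real parameter.
  have hc : ContinuousAt (fun s => (baseJac c.I (c.immExpr γ) s).det) t :=
    ContinuousAt.comp (f := fun s : Eucl n => ((0 : ℝ), s))
      (contDiffAt_det_baseJac_param (P := ℝ) c.I (f := fun _ => c.immExpr γ) (z := (0, t))
        (ContDiffAt.comp (f := Prod.snd) (g := c.immExpr γ) ((0 : ℝ), t)
          (AdaptedChart.contDiffAt_immExpr h.1) contDiffAt_snd)).continuousAt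
      (continuousAt_const.prodMk continuousAt_id)
  filter_upwards [γ.smooth.continuous.continuousAt.eventually (c.ψ.1.open_source.mem_nhds h.1),
    hc.eventually (isOpen_ne.mem_nhds h.2)] with s h1 h2
  exact (AdaptedChart.good_germAt_iff s).2 ⟨h1, h2⟩

variable [IsManifold (𝓡 N) ∞ X] [NeZero r]

theorem AdaptedChart.good_germAt (h : γ.prolong r t ∈ c.domain) : c.Good (γ.germAt t) :=
  AdaptedChart.mem_velDomain_of_proj_mem h

theorem AdaptedChart.coord_prolong {s : Eucl n} (h : c.Good (γ.germAt s)) :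
    c.coord (γ.prolong r s) = ((fun i => c.immExpr γ s (c.I i),
      fun σ (J : MultiIndex n r) => graphDeriv c.I (c.immExpr γ) σ J.list s) : c.Model r) := by
  refine (AdaptedChart.coord_mk_of_good h).trans ?_
  simp only [AdaptedChart.expr_germAt, graphDeriv_translate, add_zero]

theorem AdaptedChart.differentiableAt_coord_prolong (h : c.Good (γ.germAt t)) :
    DifferentiableAt ℝ (fun s => c.coord (γ.prolong r s)) t := by
  have h' := (AdaptedChart.good_germAt_iff t).1 h
  have hF := AdaptedChart.contDiffAt_immExpr h'.1
  have hd : ContDiffAt ℝ ∞ (fun s => ((fun i => c.immExpr γ s (c.I i),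
      fun σ (J : MultiIndex n r) => graphDeriv c.I (c.immExpr γ) σ J.list s) : c.Model r)) t := by
    refine ContDiffAt.prodMk (contDiffAt_pi.2 fun i => ?_)
      (contDiffAt_pi.2 fun σ => contDiffAt_pi.2 fun J => ?_)
    · exact (EuclideanSpace.proj (c.I i) : Eucl N →L[ℝ] ℝ).contDiff.contDiffAt.comp t hF
    · exact ContDiffAt.comp (f := fun s : Eucl n => ((0 : ℝ), s)) t
        (contDiffAt_graphDeriv_param (P := ℝ) c.I (f := fun _ => c.immExpr γ) (z := (0, t))
          (ContDiffAt.comp (f := Prod.snd) (g := c.immExpr γ) ((0 : ℝ), t) hF contDiffAt_snd)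
          h'.2 σ J.list) (contDiffAt_const.prodMk contDiffAt_id)
  refine (hd.differentiableAt (by simp)).congr_of_eventuallyEq ?_
  filter_upwards [AdaptedChart.eventually_good_germAt h] with s hs
    using AdaptedChart.coord_prolong hs

theorem AdaptedChart.basePt_coord_prolong {s : Eucl n} (h : c.Good (γ.germAt s)) :
    c.basePt r (c.coord (γ.prolong r s)) = c.immExpr γ s := by
  refine (AdaptedChart.basePt_coord h).trans ?_
  simp [AdaptedChart.expr_germAt]

theorem AdaptedChart.basePt_fderiv_coord_prolong (h : c.Good (γ.germAt t)) (v : Eucl n) :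
    c.basePt r (fderiv ℝ (fun s => c.coord (γ.prolong r s)) t v) =
      fderiv ℝ (c.immExpr γ) t v := by
  have h1 := (c.basePt r).hasFDerivAt.comp t
    (AdaptedChart.differentiableAt_coord_prolong (r := r) h).hasFDerivAt
  have h2 := ((AdaptedChart.contDiffAt_immExpr
    ((AdaptedChart.good_germAt_iff t).1 h).1).differentiableAt (by simp)).hasFDerivAt
  refine DFunLike.congr_fun (h1.unique (h2.congr_of_eventuallyEq ?_)) v
  filter_upwards [AdaptedChart.eventually_good_germAt h] with s hs
    using AdaptedChart.basePt_coord_prolong hs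

/-- The tangent vectors of prolongations are horizontal. -/
theorem AdaptedChart.horizontal_fderiv_coord_prolong (h : c.Good (γ.germAt t)) (v : Eucl n) :
    c.basePt r (fderiv ℝ (fun s => c.coord (γ.prolong r s)) t v) =
      ∑ k, (fderiv ℝ (fun s => c.coord (γ.prolong r s)) t v).1 k •
        c.basePt r (c.totalVec k (c.coord (γ.prolong r t))) := by
  have h' := (AdaptedChart.good_germAt_iff t).1 h
  set u := c.coord (γ.prolong r t) with hu
  have hF := AdaptedChart.contDiffAt_immExpr h'.1
  -- The expansion of the derivatives in the `E_k` is available at `0`; translation by `t` moves it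
  -- to `t`.
  have hpd : ∀ l, pd l (c.immExpr γ) t =
      ∑ k, pd l (c.immExpr γ) t (c.I k) • c.basePt r (c.totalVec k u) := by
    intro l
    have hF0 : ContDiffAt ℝ ∞ (fun τ => c.immExpr γ (t + τ)) 0 :=
      ContDiffAt.comp (f := fun τ => t + τ) (g := c.immExpr γ) (0 : Eucl n) (by rwa [add_zero])
        (contDiffAt_const.add contDiffAt_id)
    have := c.pd_eq_sum_totalVec u hF0 (by rw [baseJac_translate, add_zero]; exact h'.2)
      (fun σ J => by
        simp only [graphDeriv_translate, add_zero, hu, AdaptedChart.coord_prolong h]) l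
    simp only [baseJac_translate, pd_translate, add_zero] at this
    exact this
  have hlin : ∀ v, fderiv ℝ (c.immExpr γ) t v =
      ∑ k, fderiv ℝ (c.immExpr γ) t v (c.I k) • c.basePt r (c.totalVec k u) := by
    intro v
    have e : fderiv ℝ (c.immExpr γ) t v = ∑ l, v l • pd l (c.immExpr γ) t := by
      conv_lhs => rw [← (EuclideanSpace.basisFun (Fin n) ℝ).sum_repr v]
      simp [pd]
    rw [e]
    conv_lhs => rw [Finset.sum_congr rfl fun l _ => congrArg (v l • ·) (hpd l)]
    simp only [Finset.smul_sum, WithLp.ofLp_sum, WithLp.ofLp_smul, Finset.sum_apply,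
      Pi.smul_apply, Finset.sum_smul, smul_assoc]
    exact Finset.sum_comm
  -- The coefficients are the components `dx^k` of the tangent vector, since the `k`-th base
  -- component of `E_j` is `δ_{kj}`.
  have hb : ∀ k, (fderiv ℝ (fun s => c.coord (γ.prolong r s)) t v).1 k =
      fderiv ℝ (c.immExpr γ) t v (c.I k) := fun k => by
    rw [← AdaptedChart.basePt_fderiv_coord_prolong (r := r) h, c.basePt_base]
  simp only [hb]
  rw [AdaptedChart.basePt_fderiv_coord_prolong h]
  exact hlin v

/-- This says that `ω - θ₀` is contact: prolongations have horizontal tangent vectors. -/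
theorem AdaptedChart.pullback_metricForm {f : SmoothPartitionOfUnity X (𝓡 N) X Set.univ}
    (hf : f.IsSubordinate fun a => (chartAt (Eucl N) a).source)
    (h : γ.prolong r t ∈ c.domain) :
    c.pullback r γ t (c.metricForm f (c.coord (γ.prolong r t))) =
      c.pullback r γ t (c.theta r) := by
  ext v
  exact c.metricForm_apply_of_horizontal hf (AdaptedChart.basePt_coord_mem h) fun j =>
    AdaptedChart.horizontal_fderiv_coord_prolong (AdaptedChart.good_germAt h) (v j)

end Prolongation

/-! ### The class of forms of a homogeneous Lagrangian -/

section LagrangianForm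

variable {n N r : ℕ} {X : Type*} [TopologicalSpace X] [ChartedSpace (Eucl N) X]
  [IsManifold (𝓡 N) ∞ X] [NeZero r] {f : SmoothPartitionOfUnity X (𝓡 N) X Set.univ}

open Classical in
/-- The family of local expressions `g c` times the form defined by the metric, extended by `0`. -/
noncomputable def lagrangianForm (f : SmoothPartitionOfUnity X (𝓡 N) X Set.univ)
    (g : (c : AdaptedChart n N X) → c.Model r → ℝ) (c : AdaptedChart n N X) (u : c.Model r) :
    c.Model r [⋀^Fin n]→L[ℝ] ℝ :=
  if c.basePt r u ∈ c.ψ.1.target then g c u • c.metricForm f u else 0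

theorem lagrangianForm_coord (g : (c : AdaptedChart n N X) → c.Model r → ℝ)
    {c : AdaptedChart n N X} {p : Grassmannian n N r X} (hp : p ∈ c.domain) :
    lagrangianForm f g c (c.coord p) = g c (c.coord p) • c.metricForm f (c.coord p) :=
  if_pos (AdaptedChart.basePt_coord_mem hp)

/-- The factor `𝒥` in the law for the functions is exactly the one that `ω` lacks, so the products
match on overlaps. The extension by `0` is consistent because the chart image is the set tested in
the definition. -/
theorem lagrangianForm_mem (hf : f.IsSubordinate fun a => (chartAt (Eucl N) a).source)
    {g : (c : AdaptedChart n N X) → c.Model r → ℝ}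
    (hg : ∀ c : AdaptedChart n N X,
      ContDiffOn ℝ ∞ (g c) (c.coord '' (c.domain : Set (Grassmannian n N r X))))
    (hJ : ∀ (c c' : AdaptedChart n N X) (p : Grassmannian n N r X), p ∈ c.domain →
      p ∈ c'.domain → g c (c.coord p) = c.jacobian c' p * g c' (c'.coord p)) :
    lagrangianForm f g ∈ formSubmodule n N r n X := by
  refine ⟨fun c => ?_, fun c u hu => ?_, fun c c' p hp hp' => ?_⟩
  · have hs : ContDiffOn ℝ ∞ (fun u => g c u • c.metricForm f u)
        (c.coord '' (c.domain : Set (Grassmannian n N r X))) := by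
      refine (hg c).smul fun u hu => (c.contDiffAt_metricForm hf ?_).contDiffWithinAt
      rwa [c.coord_image_domain] at hu
    refine hs.congr fun u hu => if_pos ?_
    rwa [c.coord_image_domain] at hu
  · rw [c.coord_image_domain] at hu
    exact if_neg hu
  · rw [lagrangianForm_coord g hp, lagrangianForm_coord g hp', hJ c c' p hp hp', mul_comm,
      mul_smul, AdaptedChart.metricForm_transition hf hp hp']
    rfl

theorem contactOn_lagrangianForm_sub
    (hf : f.IsSubordinate fun a => (chartAt (Eucl N) a).source)
    {g : (c : AdaptedChart n N X) → c.Model r → ℝ} {c : AdaptedChart n N X}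
    {L : Grassmannian n N r X → ℝ} (hL : ∀ p ∈ c.domain, L p = g c (c.coord p)) :
    c.ContactOn fun p => lagrangianForm f g c (c.coord p) - L p • c.theta r := by
  intro γ t h
  have e : ∀ (a : ℝ) (α β : c.Model r [⋀^Fin n]→L[ℝ] ℝ), c.pullback r γ t (a • α - a • β) =
      a • c.pullback r γ t α - a • c.pullback r γ t β := fun _ _ _ => rfl
  change c.pullback r γ t (lagrangianForm f g c (c.coord (γ.prolong r t)) -
    L (γ.prolong r t) • c.theta r) = 0
  rw [lagrangianForm_coord g h, hL _ h, e, AdaptedChart.pullback_metricForm hf h, sub_self]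

/-- The third assertion: existence and uniqueness of the class of forms. -/
theorem existsUnique_hasLocalExpr [T2Space X] [SecondCountableTopology X]
    {L : AdaptedChart n N X → Grassmannian n N r X → ℝ} (hL : ∀ c : AdaptedChart n N X, c.SmoothOn (L c))
    (hJ : ∀ (c c' : AdaptedChart n N X) (p : Grassmannian n N r X), p ∈ c.domain →
      p ∈ c'.domain → L c p = c.jacobian c' p * L c' p) :
    ∃! Λ : Form n N r n X ⧸ ContactForm n N r n X, ∀ c, HasLocalExpr Λ c (L c) := by
  -- With the Hausdorff and countability assumptions this yields a partition of unity on `X`; none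
  -- is needed on `Pʳₙ X`.
  have : LocallyCompactSpace X := ChartedSpace.locallyCompactSpace (Eucl N) X
  obtain ⟨f, hf⟩ := SmoothPartitionOfUnity.exists_isSubordinate_chartAt_source (𝓡 N) X
  choose g hg hLg using hL
  let ξ : Form n N r n X := (⟨lagrangianForm f g, lagrangianForm_mem hf hg fun c c' p hp hp' => by
    rw [← hLg c p hp, ← hLg c' p hp', hJ c c' p hp hp']⟩ : formSubmodule n N r n X)
  have add : ∀ (c : AdaptedChart n N X) (γ : Immersion n N X) (t : Eucl n)
      (α β : c.Model r [⋀^Fin n]→L[ℝ] ℝ),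
      c.pullback r γ t (α + β) = c.pullback r γ t α + c.pullback r γ t β := fun _ _ _ _ _ => rfl
  refine ⟨Submodule.Quotient.mk ξ, fun c ζ hζ γ t h => ?_, fun Λ hΛ => ?_⟩
  -- An arbitrary representative `ζ` is compared with `ξ`: `ζ - L θ₀ = (ζ - ξ) + (ξ - L θ₀)`, both
  -- summands being contact.
  · have h1 : c.pullback r γ t ((ζ - ξ).inChart c (c.coord (γ.prolong r t))) = 0 :=
      (Submodule.Quotient.eq _).1 hζ c γ t h
    have h2 := contactOn_lagrangianForm_sub hf (hLg c) γ t h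
    have e : ζ.inChart c (c.coord (γ.prolong r t)) - L c (γ.prolong r t) • c.theta r =
        (ζ - ξ).inChart c (c.coord (γ.prolong r t)) +
          (lagrangianForm f g c (c.coord (γ.prolong r t)) - L c (γ.prolong r t) • c.theta r) :=
      (sub_add_sub_cancel _ _ _).symm
    change c.pullback r γ t (ζ.inChart c (c.coord (γ.prolong r t)) -
      L c (γ.prolong r t) • c.theta r) = 0
    rw [e, add, h1, h2, add_zero]
  -- The same decomposition read backwards: two of the three terms are contact, hence so is `ζ - ξ`,
  -- in every chart.
  · obtain ⟨ζ, rfl⟩ := Submodule.Quotient.mk_surjective _ Λ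
    refine (Submodule.Quotient.eq _).2 fun c γ t h => ?_
    have h1 := hΛ c ζ rfl γ t h
    have h2 := contactOn_lagrangianForm_sub hf (hLg c) γ t h
    have e : ζ.inChart c (c.coord (γ.prolong r t)) - L c (γ.prolong r t) • c.theta r =
        (ζ - ξ).inChart c (c.coord (γ.prolong r t)) +
          (lagrangianForm f g c (c.coord (γ.prolong r t)) - L c (γ.prolong r t) • c.theta r) :=
      (sub_add_sub_cancel _ _ _).symm
    change c.pullback r γ t (ζ.inChart c (c.coord (γ.prolong r t)) -
      L c (γ.prolong r t) • c.theta r) = 0 at h1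
    rwa [e, add, h2, add_zero] at h1

end LagrangianForm

end GrassmannJet

theorem mainTheorem5 (n N r : ℕ) (hn : 1 ≤ n) (hnN : n ≤ N) [NeZero r]
    {X : Type*} [TopologicalSpace X] [T2Space X] [SecondCountableTopology X]
    [ChartedSpace (GrassmannJet.Eucl N) X] [IsManifold (𝓡 N) ∞ X]
    (ℒ : GrassmannJet.HomogeneousLagrangian n N r X) :
    (∀ c : GrassmannJet.AdaptedChart n N X, ∃ L, ℒ.IsLocal c L) ∧
    ∀ L : GrassmannJet.AdaptedChart n N X → GrassmannJet.Grassmannian n N r X → ℝ,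
      (∀ c, ℒ.IsLocal c (L c)) →
      (∀ (c c' : GrassmannJet.AdaptedChart n N X) (p : GrassmannJet.Grassmannian n N r X),
        p ∈ c.domain → p ∈ c'.domain → L c p = c.jacobian c' p * L c' p) ∧
      ∃! Λ : GrassmannJet.Form n N r n X ⧸ GrassmannJet.ContactForm n N r n X,
        ∀ c, GrassmannJet.HasLocalExpr Λ c (L c) := by
  refine ⟨ℒ.exists_isLocal, fun L hL => ?_⟩
  have hJ : ∀ (c c' : GrassmannJet.AdaptedChart n N X) (p : GrassmannJet.Grassmannian n N r X),
      p ∈ c.domain → p ∈ c'.domain → L c p = c.jacobian c' p * L c' p :=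
    fun c c' p hp hp' => ℒ.local_eq_jacobian_mul (hL c) (hL c') hp hp'
  exact ⟨hJ, GrassmannJet.existsUnique_hasLocalExpr (fun c => (hL c).1) hJ⟩
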